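/- Let $N\ge 0$, $m\ge1$ be integers and $\mathbb T^N=\mathbb R^N/\mathbb Z^N$. Let $H_1,\dots,H_m:\mathbb T^N\times\mathbb R^N\to\mathbb R$ be continuous, convex in the second variable, and such that for each $i$ there are functions $\alpha_i,\beta_i:[0,\infty)\to\mathbb R$ with $\alpha_i(h),\beta_i(h)\to+\infty$ as $h\to+\infty$ and $\alpha_i(|p|)\le H_i(x,p)\le\beta_i(|p|)$ for all $(x,p)$. Let $B(x)=(b_{ij}(x))$ be an $m\times m$ real matrix depending continuously on $x\in\mathbb T^N$ such that, for every $x$: $b_{ij}(x)\le 0$ for $j\ne i$; $\sum_{j}b_{ij}(x)=0$ for every $i$; and $B(x)$ is irreducible, i.e. for every nonempty proper subset $\mathcal I\subsetneq\{1,\dots,m\}$ there are $i\in\mathcal I$, $j\notin\mathcal I$ with $b_{ij}(x)\neq0$. For $a\in\mathbb R$, a continuous $\mathbf u=(u_1,\dots,u_m):\mathbb T^N\to\mathbb R^m$ is a (viscosity) subsolution, respectively supersolution, of the system $$H_i(x,Du_i)+\big(B(x)\mathbf u(x)\big)_i=a\quad\text{in }\mathbb T^N,\qquad i=1,\dots,m,$$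 if for all $x\in\mathbb T^N$ and all $i$ one has $H_i(x,p)+(B(x)\mathbf u(x))_i\le a$ for every $p\in D^+u_i(x)$, respectively $H_i(x,p)+(B(x)\mathbf u(x))_i\ge a$ for every $p\in D^-u_i(x)$. Here $D^+u_i(x)$ (respectively $D^-u_i(x)$) is the set of gradients $D\phi(x)$ of functions $\phi$ that are $C^1$ near $x$ and such that $u_i-\phi$ has a local maximum (respectively minimum) at $x$. A solution is a function that is both a subsolution and a supersolution. The critical value $c$ is the infimum of all $a\in\mathbb R$ for which the system has a subsolution; subsolutions, supersolutions and solutions of the system with $a=c$ are called critical. Put $$\Phi_{i,j}(y,x)=\sup\{v_i(x)-v_j(y):\ \mathbf v\text{ a critical subsolution}\}.$$ Fix any $k\in\{1,\dots,m\}$ and let the Aubry set be $$\mathcal A=\{y\in\mathbb T^N:\ (\Phi_{1,k}(y,\cdot),\dots,\Phi_{m,k}(y,\cdot))\text{ is a critical solution}\}.$$ Theorem. Let $\mathbf v$ be a critical subsolution and $\mathbf u$ a critical supersolution, and assume that for every $x\in\mathcal A$ there exists $i\in\{1,\dots,m\}$ with $v_i(x)\le u_i(x)$. Then $v_i(x)\le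 u_i(x)$ for every $x\in\mathbb T^N$ and every $i\in\{1,\dots,m\}$. In particular, two critical solutions that coincide on $\mathcal A$ coincide on all of $\mathbb T^N$. -/

import Mathlib

open scoped NNReal Topology Matrix

noncomputable section

namespace WCS

/-- The flat torus `ℝ^N / ℤ^N`. -/
abbrev Torus (N : ℕ) : Type := UnitAddTorus (Fin N)

/-- The Euclidean space `ℝ^N` of momenta. -/
abbrev Momentum (N : ℕ) : Type := EuclideanSpace ℝ (Fin N)

/-- The point `x + [h]` of the torus, for `x` in the torus and `h ∈ ℝ^N`. For fixed `x`, the map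
`h ↦ x + [h]` is the standard local chart of the torus centered at `x` (it is a local isometry and
maps neighborhoods of `0` to neighborhoods of `x`). -/
def translate {N : ℕ} (x : Torus N) (h : Momentum N) : Torus N :=
  fun k => x k + ((h k : ℝ) : UnitAddCircle)

/-- A convex Hamiltonian: (H1) continuous in `(x, p)`, (H2) convex in `p`, (H3) bounded from below
and above by coercive functions of `|p|`. -/
structure IsConvexHamiltonian {N : ℕ} (H : Torus N → Momentum N → ℝ) : Prop where
  continuous : Continuous (fun z : Torus N × Momentum N => H z.1 z.2)
  convex : ∀ x, ConvexOn ℝ Set.univ (H x)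
  coercive : ∃ α β : ℝ≥0 → ℝ, Filter.Tendsto α Filter.atTop Filter.atTop ∧
    Filter.Tendsto β Filter.atTop Filter.atTop ∧
    ∀ x p, α ‖p‖₊ ≤ H x p ∧ H x p ≤ β ‖p‖₊

/-- Coupling matrices: nonpositive off-diagonal entries and nonnegative row sums. -/
structure IsCoupling {m : ℕ} (B : Matrix (Fin m) (Fin m) ℝ) : Prop where
  offDiag_nonpos : ∀ i j, j ≠ i → B i j ≤ 0
  rowSum_nonneg : ∀ i, 0 ≤ ∑ j, B i j

/-- Degenerate matrices: vanishing row sums. -/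
def IsDegenerate {m : ℕ} (B : Matrix (Fin m) (Fin m) ℝ) : Prop :=
  ∀ i, ∑ j, B i j = 0

/-- Irreducible matrices: every nonempty proper set of indices is connected to its complement by
a nonzero entry. -/
def IsIrreducible {m : ℕ} (B : Matrix (Fin m) (Fin m) ℝ) : Prop :=
  ∀ I : Set (Fin m), I.Nonempty → I ≠ Set.univ → ∃ i ∈ I, ∃ j ∉ I, B i j ≠ 0

/-- The set `D⁺u(x)`: gradients at `x` of the `C¹` functions `φ` (defined near `x`, read in the
chart `h ↦ x + [h]`) such that `u - φ` has a local maximum at `x`. -/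
def superdifferential {N : ℕ} (u : Torus N → ℝ) (x : Torus N) : Set (Momentum N) :=
  {p | ∃ φ : Momentum N → ℝ, ContDiffAt ℝ 1 φ 0 ∧
    IsLocalMax (fun h => u (translate x h) - φ h) 0 ∧ HasGradientAt φ p 0}

/-- The set `D⁻u(x)`: gradients at `x` of the `C¹` functions `φ` (defined near `x`, read in the
chart `h ↦ x + [h]`) such that `u - φ` has a local minimum at `x`. -/
def subdifferential {N : ℕ} (u : Torus N → ℝ) (x : Torus N) : Set (Momentum N) :=
  {p | ∃ φ : Momentum N → ℝ, ContDiffAt ℝ 1 φ 0 ∧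
    IsLocalMin (fun h => u (translate x h) - φ h) 0 ∧ HasGradientAt φ p 0}

section System

variable {N m : ℕ} (H : Fin m → Torus N → Momentum N → ℝ)
  (B : Torus N → Matrix (Fin m) (Fin m) ℝ)

/-- Continuous viscosity subsolutions of `H_i(x, Du_i) + (B(x) u(x))_i = a`, `i = 1, …, m`. -/
structure IsSubsolution (a : ℝ) (u : Torus N → Fin m → ℝ) : Prop where
  continuous : Continuous u
  le : ∀ x i, ∀ p ∈ superdifferential (fun y => u y i) x, H i x p + (B x *ᵥ u x) i ≤ a

/-- Continuous viscosity supersolutions of `H_i(x, Du_i) + (B(x) u(x))_i = a`, `i = 1, …, m`. -/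
structure IsSupersolution (a : ℝ) (u : Torus N → Fin m → ℝ) : Prop where
  continuous : Continuous u
  ge : ∀ x i, ∀ p ∈ subdifferential (fun y => u y i) x, a ≤ H i x p + (B x *ᵥ u x) i

/-- Continuous viscosity solutions of `H_i(x, Du_i) + (B(x) u(x))_i = a`, `i = 1, …, m`. -/
def IsSolution (a : ℝ) (u : Torus N → Fin m → ℝ) : Prop :=
  IsSubsolution H B a u ∧ IsSupersolution H B a u

/-- The critical value: the infimum of the `a` for which the system has a subsolution. -/
def criticalValue : ℝ := sInf {a : ℝ | ∃ u, IsSubsolution H B a u}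

/-- Subsolutions of the critical system, i.e. of the system with `a = c`. -/
def IsCriticalSubsolution (u : Torus N → Fin m → ℝ) : Prop :=
  IsSubsolution H B (criticalValue H B) u

/-- Supersolutions of the critical system, i.e. of the system with `a = c`. -/
def IsCriticalSupersolution (u : Torus N → Fin m → ℝ) : Prop :=
  IsSupersolution H B (criticalValue H B) u

/-- Solutions of the critical system, i.e. of the system with `a = c`. -/
def IsCriticalSolution (u : Torus N → Fin m → ℝ) : Prop :=
  IsSolution H B (criticalValue H B) u

/-- The Mañé matrix `Φ_{i,j}(y, x) = sup (v_i(x) - v_j(y))`, the supremum being over all critical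
subsolutions `v`. -/
def mane (i j : Fin m) (y x : Torus N) : ℝ :=
  sSup {r : ℝ | ∃ v, IsCriticalSubsolution H B v ∧ r = v x i - v y j}

/-- The Aubry set: the points `y` such that `Φ_{·,k}(y, ·)` is a critical solution, where `k` is
a fixed index. -/
def aubrySet (k : Fin m) : Set (Torus N) :=
  {y | IsCriticalSolution H B (fun x i => mane H B i k y x)}

end System

end WCS

end

/-! Let `M` be the largest value of the components of `v - u`. Doubling of variables, followed by
the maximum principle for irreducible coupling matrices, shows that wherever one component reaches
`M` all of them do (`sub_eq_of_isMax`), and that no equation of the subsolution can be locally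
strict there (`not_isStrictNear_of_isMax`).

The Aubry set enters through its complement. The column `Φ_{·,k}(y,·)` is the largest critical
subsolution whose `k`-th component vanishes at `y`. A Perron bump (`IsSubsolution.exists_bump`)
contradicts this maximality wherever the supersolution test fails, except in component `k` at `y`
itself. For `y` off the Aubry set the test must therefore fail exactly there, and the bumped
function is a critical subsolution with strict `k`-th equation near `y`.

Suppose the contact set `{v_i - u_i = M for some i}` missed the Aubry set. By compactness and
convexity of the Hamiltonians, finitely many of these strict subsolutions average to one `w`,
uniformly strict near the contact set. For small `t`, the difference of `(1-t)v + tw` and `u` still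
peaks near the contact set, where the combination is strict: a contradiction
(`exists_mem_aubrySet_isMax`). So `M` is attained on the Aubry set, by every component at once,
which is why the hypothesis is needed for one index only. -/

namespace WCS

open Filter Set

/-! ### Charts of the torus -/

section TorusChart

variable {N : ℕ}

lemma translate_zero (x : Torus N) : translate x 0 = x := by
  funext k; simp [translate]

lemma translate_translate (x : Torus N) (z h : Momentum N) :
    translate (translate x z) h = translate x (z + h) := by
  funext k; simp [translate, add_assoc]

lemma continuous_translate (x : Torus N) : Continuous (translate x) := by
  unfold translate
  refine continuous_pi fun k => continuous_const.add ?_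
  exact (AddCircle.continuous_mk' 1).comp (by fun_prop)

lemma tendsto_translate (x : Torus N) : Tendsto (translate x) (𝓝 0) (𝓝 x) := by
  simpa [translate_zero] using (continuous_translate x).tendsto 0

lemma isOpenMap_translate (x : Torus N) : IsOpenMap (translate x) := by
  have h1 : IsOpenMap (fun t : ℝ => (t : UnitAddCircle)) := QuotientAddGroup.isOpenMap_coe
  have h2 : IsOpenMap (Pi.map fun (_ : Fin N) (t : ℝ) => (t : UnitAddCircle)) :=
    IsOpenMap.piMap (fun _ => h1) (Eventually.of_forall fun _ => QuotientAddGroup.mk_surjective)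
  have h3 := (Homeomorph.addLeft x).isOpenMap.comp
    (h2.comp (EuclideanSpace.equiv (Fin N) ℝ).toHomeomorph.isOpenMap)
  exact h3

lemma map_translate_nhds (x : Torus N) (z : Momentum N) :
    map (translate x) (𝓝 z) = 𝓝 (translate x z) :=
  le_antisymm (continuous_translate x).continuousAt ((isOpenMap_translate x).nhds_le z)

lemma map_translate_nhds_zero (x : Torus N) : map (translate x) (𝓝 0) = 𝓝 x := by
  rw [map_translate_nhds, translate_zero]

/-- The coordinates of `h - h'` are integers of absolute value less than one. -/
lemma translate_injective_of_norm_sub_lt (x : Torus N) {h h' : Momentum N}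
    (hn : ‖h - h'‖ < 1) (he : translate x h = translate x h') : h = h' := by
  ext k
  have h1 := congrFun he k
  have h2 : (((h k - h' k : ℝ)) : UnitAddCircle) = 0 := by
    rw [AddCircle.coe_sub, sub_eq_zero]
    exact add_left_cancel h1
  obtain ⟨n, hn'⟩ := (AddCircle.coe_eq_zero_iff (1 : ℝ)).1 h2
  have h3 : |h k - h' k| < 1 := lt_of_le_of_lt (PiLp.norm_apply_le (h - h') k) hn
  have h4 : (n : ℝ) = h k - h' k := by simpa using hn'
  rw [← h4] at h3
  have h5 : |n| < 1 := by
    rwa [← Int.cast_abs, ← Int.cast_one, Int.cast_lt] at h3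
  rw [Int.abs_lt_one_iff.1 h5] at h4
  push_cast at h4
  linarith

lemma exists_translate_eq (x y : Torus N) :
    ∃ h : Momentum N, ‖h‖ ≤ √N ∧ translate x h = y := by
  have : ∀ k, ∃ t : ℝ, |t| ≤ 1 ∧ (t : UnitAddCircle) = y k - x k := fun k => by
    obtain ⟨⟨t, ht⟩, h⟩ := (AddCircle.equivIco (1 : ℝ) 0).symm.surjective (y k - x k)
    refine ⟨t, abs_le.2 ⟨by linarith [ht.1], by linarith [ht.2]⟩, h⟩
  choose t ht ht' using this
  refine ⟨WithLp.toLp 2 t, ?_, ?_⟩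
  · rw [EuclideanSpace.norm_eq]
    refine Real.sqrt_le_sqrt ?_
    calc ∑ k, ‖t k‖ ^ 2 ≤ ∑ _k : Fin N, (1 : ℝ) :=
          Finset.sum_le_sum fun k _ => pow_le_one₀ (norm_nonneg _) (ht k)
      _ = N := by simp
  · funext k
    simp [translate, ht']

end TorusChart

/-! ### Calculus of test functions -/

/-- `φ` is `C¹` near `z`, with gradient `p` at `z`. -/
def IsC1WithGradient {N : ℕ} (φ : Momentum N → ℝ) (p z : Momentum N) : Prop :=
  ContDiffAt ℝ 1 φ z ∧ HasGradientAt φ p z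

namespace IsC1WithGradient

variable {N : ℕ} {φ ψ : Momentum N → ℝ} {p q z : Momentum N}

lemma const (c : ℝ) : IsC1WithGradient (fun _ => c) 0 z :=
  ⟨contDiffAt_const, hasGradientAt_const _ _⟩

lemma add (hφ : IsC1WithGradient φ p z) (hψ : IsC1WithGradient ψ q z) :
    IsC1WithGradient (fun x => φ x + ψ x) (p + q) z := by
  refine ⟨hφ.1.add hψ.1, ?_⟩
  rw [hasGradientAt_iff_hasFDerivAt, map_add]
  exact hφ.2.hasFDerivAt.add hψ.2.hasFDerivAt

lemma const_mul (c : ℝ) (hφ : IsC1WithGradient φ p z) :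
    IsC1WithGradient (fun x => c * φ x) (c • p) z := by
  refine ⟨contDiffAt_const.mul hφ.1, ?_⟩
  rw [hasGradientAt_iff_hasFDerivAt]
  refine (hφ.2.hasFDerivAt.const_mul c).congr_fderiv ?_
  ext v
  simp

lemma norm_sub_sq (w z : Momentum N) :
    IsC1WithGradient (fun x => ‖x - w‖ ^ 2) ((2 : ℝ) • (z - w)) z := by
  refine ⟨(contDiffAt_id.sub contDiffAt_const).norm_sq ℝ, ?_⟩
  rw [hasGradientAt_iff_hasFDerivAt]
  refine ((hasFDerivAt_id z).sub_const w).norm_sq.congr_fderiv ?_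
  ext v
  simp

lemma norm_sq (z : Momentum N) :
    IsC1WithGradient (fun x => ‖x‖ ^ 2) ((2 : ℝ) • z) z := by
  simpa using norm_sub_sq 0 z

lemma comp_affine {s : ℝ} {w : Momentum N} (hφ : IsC1WithGradient φ p (s • z + w)) :
    IsC1WithGradient (fun x => φ (s • x + w)) (s • p) z := by
  refine ⟨ContDiffAt.comp z hφ.1 (by fun_prop), ?_⟩
  rw [hasGradientAt_iff_hasFDerivAt]
  have h := HasFDerivAt.comp z hφ.2.hasFDerivAt (((hasFDerivAt_id z).const_smul s).add_const w)
  refine h.congr_fderiv ?_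
  ext v
  simp

lemma _root_.ContDiffAt.isC1WithGradient (h : ContDiffAt ℝ 1 φ z) :
    IsC1WithGradient φ (gradient φ z) z :=
  ⟨h, (h.differentiableAt one_ne_zero).hasGradientAt⟩

lemma eventually (h : ContDiffAt ℝ 1 φ z) :
    ∀ᶠ x in 𝓝 z, IsC1WithGradient φ (gradient φ x) x :=
  (h.eventually (by simp)).mono fun _ hx => hx.isC1WithGradient

lemma continuousAt_gradient (h : ContDiffAt ℝ 1 φ z) : ContinuousAt (gradient φ) z :=
  (InnerProductSpace.toDual ℝ (Momentum N)).symm.continuous.continuousAt.comp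
    (h.continuousAt_fderiv one_ne_zero)

lemma tendsto_gradient (h : IsC1WithGradient φ p z) : Tendsto (gradient φ) (𝓝 z) (𝓝 p) := by
  simpa [h.2.gradient] using (continuousAt_gradient h.1).tendsto

end IsC1WithGradient

/-! ### Super- and subdifferentials read in a fixed chart -/

section Differentials

variable {N : ℕ} {u : Torus N → ℝ}

lemma mem_superdifferential_of_chart {x : Torus N} {φ : Momentum N → ℝ} {p z : Momentum N}
    (hφ : IsC1WithGradient φ p z) (hmax : IsLocalMax (fun h => u (translate x h) - φ h) z) :
    p ∈ superdifferential u (translate x z) := by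
  have h1 : IsC1WithGradient (fun h => φ (z + h)) p 0 := by
    have := IsC1WithGradient.comp_affine (φ := φ) (s := 1) (w := z) (z := 0) (p := p)
      (by simpa using hφ)
    simpa [add_comm] using this
  refine ⟨fun h => φ (z + h), h1.1, ?_, h1.2⟩
  have h2 : Tendsto (fun h : Momentum N => z + h) (𝓝 0) (𝓝 z) := by
    simpa using tendsto_const_nhds.add (tendsto_id (x := 𝓝 (0 : Momentum N)))
  have h3 := h2.eventually hmax
  filter_upwards [h3] with h hh
  simpa [translate_translate] using hh

lemma mem_subdifferential_of_chart {x : Torus N} {φ : Momentum N → ℝ} {p z : Momentum N}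
    (hφ : IsC1WithGradient φ p z) (hmin : IsLocalMin (fun h => u (translate x h) - φ h) z) :
    p ∈ subdifferential u (translate x z) := by
  have h1 : IsC1WithGradient (fun h => φ (z + h)) p 0 := by
    have := IsC1WithGradient.comp_affine (φ := φ) (s := 1) (w := z) (z := 0) (p := p)
      (by simpa using hφ)
    simpa [add_comm] using this
  refine ⟨fun h => φ (z + h), h1.1, ?_, h1.2⟩
  have h2 : Tendsto (fun h : Momentum N => z + h) (𝓝 0) (𝓝 z) := by
    simpa using tendsto_const_nhds.add (tendsto_id (x := 𝓝 (0 : Momentum N)))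
  have h3 := h2.eventually hmin
  filter_upwards [h3] with h hh
  simpa [translate_translate] using hh

lemma superdifferential_add_const (c : ℝ) (x : Torus N) :
    superdifferential (fun y => u y + c) x ⊆ superdifferential u x := by
  rintro p ⟨φ, h1, h2, h3⟩
  refine ⟨φ, h1, ?_, h3⟩
  filter_upwards [h2] with h hh
  linarith

end Differentials

/-! ### Consequences of coercivity -/

section Hamiltonian

variable {N : ℕ} {H : Torus N → Momentum N → ℝ}

lemma IsConvexHamiltonian.exists_norm_le (hH : IsConvexHamiltonian H) (C : ℝ) :
    ∃ L : ℝ, 0 ≤ L ∧ ∀ x p, H x p ≤ C → ‖p‖ ≤ L := by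
  obtain ⟨α, β, hα, -, hb⟩ := hH.coercive
  obtain ⟨L, hL⟩ := eventually_atTop.1 (hα.eventually_gt_atTop C)
  refine ⟨L, L.2, fun x p hp => ?_⟩
  by_contra hlt
  have := hL ‖p‖₊ (by exact_mod_cast (not_le.1 hlt).le)
  linarith [(hb x p).1]

lemma IsConvexHamiltonian.exists_lower_bound (hH : IsConvexHamiltonian H) :
    ∃ μ : ℝ, ∀ x p, μ ≤ H x p := by
  obtain ⟨L, hL0, hL⟩ := hH.exists_norm_le 0
  have hK : IsCompact ((univ : Set (Torus N)) ×ˢ Metric.closedBall (0 : Momentum N) L) :=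
    isCompact_univ.prod (isCompact_closedBall _ _)
  obtain ⟨μ, hμ⟩ := hK.bddBelow_image hH.continuous.continuousOn
  refine ⟨min μ 0, fun x p => ?_⟩
  by_cases hp : H x p ≤ 0
  · refine (min_le_left _ _).trans (hμ ⟨(x, p), ⟨mem_univ _, ?_⟩, rfl⟩)
    simpa using hL x p hp
  · exact (min_le_right _ _).trans (not_le.1 hp).le

lemma IsConvexHamiltonian.tendsto (hH : IsConvexHamiltonian H) {ι : Type*} {l : Filter ι}
    {x : ι → Torus N} {p : ι → Momentum N} {x₀ : Torus N} {p₀ : Momentum N}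
    (hx : Tendsto x l (𝓝 x₀)) (hp : Tendsto p l (𝓝 p₀)) :
    Tendsto (fun n => H (x n) (p n)) l (𝓝 (H x₀ p₀)) :=
  (hH.continuous.tendsto (x₀, p₀)).comp (hx.prodMk_nhds hp)

end Hamiltonian

/-! ### Lipschitz bounds from supergradients -/

/-- `u` is `L`-Lipschitz when read in the charts of the torus. -/
def ChartLipschitz {N : ℕ} (L : ℝ) (u : Torus N → ℝ) : Prop :=
  ∀ x h, u (translate x h) ≤ u x + L * ‖h‖

section ScalarFunctions

variable {N : ℕ} {u : Torus N → ℝ}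

lemma ChartLipschitz.le_add {L : ℝ} (hu : ChartLipschitz L u) (x : Torus N) (h h' : Momentum N) :
    u (translate x h) ≤ u (translate x h') + L * ‖h - h'‖ := by
  have := hu (translate x h') (h - h')
  rwa [translate_translate, add_sub_cancel] at this

lemma ChartLipschitz.continuous {L : ℝ} (hu : ChartLipschitz L u) : Continuous u := by
  rw [continuous_iff_continuousAt]
  intro x
  rw [ContinuousAt, ← map_translate_nhds_zero x, tendsto_map'_iff]
  have h1 : Tendsto (fun h : Momentum N => L * ‖h‖) (𝓝 0) (𝓝 0) := by
    simpa using (tendsto_norm_zero (E := Momentum N)).const_mul L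
  refine tendsto_order.2 ⟨fun a ha => ?_, fun a ha => ?_⟩
  · filter_upwards [h1.eventually_lt_const (sub_pos.2 ha)] with h hh
    have := hu.le_add x 0 h
    rw [translate_zero, zero_sub, norm_neg] at this
    simp only [Function.comp]
    linarith
  · filter_upwards [h1.eventually_lt_const (sub_pos.2 ha)] with h hh
    have := hu x h
    simp only [Function.comp]
    linarith

lemma exists_forall_abs_le (hu : Continuous u) : ∃ R : ℝ, 0 ≤ R ∧ ∀ x, |u x| ≤ R := by
  obtain ⟨R, hR⟩ := isCompact_univ.exists_bound_of_continuousOn hu.continuousOn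
  exact ⟨max R 0, le_max_right _ _, fun x => (hR x (mem_univ x)).trans (le_max_left _ _)⟩

/-- The points with nonempty superdifferential are dense. -/
lemma frequently_superdifferential_nonempty (hu : Continuous u) (x : Torus N) :
    ∃ᶠ y in 𝓝 x, (superdifferential u y).Nonempty := by
  intro hP
  rw [← map_translate_nhds_zero x, eventually_map, Metric.eventually_nhds_iff_ball] at hP
  obtain ⟨ε, hε, hP⟩ := hP
  obtain ⟨R, hR0, hR⟩ := exists_forall_abs_le hu
  -- On the sphere of radius `ε / 2` the penalty equals `2R + 1`, more than the oscillation of `u`,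
  -- so the maximum is interior.
  set n : ℝ := (2 * R + 1) / (ε / 2) ^ 2 with hn
  have hn' : n * (ε / 2) ^ 2 = 2 * R + 1 := by rw [hn]; field_simp
  have hcont : Continuous fun h : Momentum N => u (translate x h) - n * ‖h‖ ^ 2 := by
    have : Continuous fun h => u (translate x h) := hu.comp (continuous_translate x)
    exact this.sub (by fun_prop)
  obtain ⟨z, hz, hmax⟩ := (isCompact_closedBall (0 : Momentum N) (ε / 2)).exists_isMaxOn
    ⟨0, by simp; positivity⟩ hcont.continuousOn
  have hz1 : ‖z‖ ≤ ε / 2 := by simpa using hz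
  have hz2 : ‖z‖ < ε / 2 := by
    refine lt_of_le_of_ne hz1 fun h => ?_
    have h0 : u (translate x 0) - n * ‖(0 : Momentum N)‖ ^ 2 ≤ u (translate x z) - n * ‖z‖ ^ 2 :=
      hmax (by simp; positivity)
    rw [h, hn', norm_zero] at h0
    have h1 := abs_le.1 (hR (translate x 0))
    have h2 := abs_le.1 (hR (translate x z))
    linarith
  refine hP z (by simp; linarith) ⟨n • ((2 : ℝ) • z), ?_⟩
  refine mem_superdifferential_of_chart ((IsC1WithGradient.norm_sq z).const_mul n) ?_
  exact hmax.isLocalMax (mem_of_superset (Metric.isOpen_ball.mem_nhds (by simpa using hz2))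
    Metric.ball_subset_closedBall)

/-- Compare `u` with a cone of slope `L' > L` with apex at `x`. Away from the apex the cone is
smooth with gradient of norm `L'`, too large for a supergradient, so the maximum of the difference
sits at the apex. Then let `L'` decrease to `L`. -/
lemma chartLipschitz_of_superdifferential (hu : Continuous u) {L : ℝ} (hL : 0 ≤ L)
    (h : ∀ x, ∀ p ∈ superdifferential u x, ‖p‖ ≤ L) : ChartLipschitz L u := by
  intro x y
  obtain ⟨R, hR0, hR⟩ := exists_forall_abs_le hu
  have key : ∀ L' > L, u (translate x y) ≤ u x + L' * ‖y‖ := by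
    intro L' hL'
    have hL'0 : 0 < L' := hL.trans_lt hL'
    -- The ball must contain `y`, and the cone must beat the oscillation of `u` on its boundary.
    set ρ : ℝ := max ‖y‖ ((2 * R + 1) / L') with hρ
    have hρ1 : 2 * R + 1 ≤ L' * ρ := by
      rw [← div_le_iff₀' hL'0]; exact le_max_right _ _
    have hρ0 : 0 ≤ ρ := (norm_nonneg y).trans (le_max_left _ _)
    have hcont : Continuous fun h : Momentum N => u (translate x h) - L' * ‖h‖ := by
      have : Continuous fun h => u (translate x h) := hu.comp (continuous_translate x)
      exact this.sub (by fun_prop)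
    obtain ⟨z, hz, hmax⟩ := (isCompact_closedBall (0 : Momentum N) ρ).exists_isMaxOn
      ⟨0, by simpa using hρ0⟩ hcont.continuousOn
    have hz1 : ‖z‖ ≤ ρ := by simpa using hz
    have hmax' : ∀ h : Momentum N, ‖h‖ ≤ ρ →
        u (translate x h) - L' * ‖h‖ ≤ u (translate x z) - L' * ‖z‖ := fun h hh =>
      hmax (by simpa using hh)
    have hz2 : ‖z‖ < ρ := by
      refine lt_of_le_of_ne hz1 fun he => ?_
      have h0 := hmax' 0 (by simpa using hρ0)
      rw [he, norm_zero] at h0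
      have h1 := abs_le.1 (hR (translate x 0))
      have h2 := abs_le.1 (hR (translate x z))
      linarith
    by_cases hz0 : z = 0
    · have := hmax' y (le_max_left _ _)
      rw [hz0, translate_zero, norm_zero] at this
      linarith
    · exfalso
      have hd : ContDiffAt ℝ 1 (fun h : Momentum N => ‖h‖) z := contDiffAt_norm ℝ hz0
      have hp := h _ _ (mem_superdifferential_of_chart (hd.isC1WithGradient.const_mul L')
        (hmax.isLocalMax (mem_of_superset (Metric.isOpen_ball.mem_nhds (by simpa using hz2))
          Metric.ball_subset_closedBall)))
      have : Nontrivial (Momentum N) := ⟨z, 0, hz0⟩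
      have hg : ‖gradient (fun h : Momentum N => ‖h‖) z‖ = 1 := by
        rw [gradient, LinearIsometryEquiv.norm_map]
        exact norm_fderiv_norm (hd.differentiableAt one_ne_zero)
      rw [norm_smul, hg, Real.norm_of_nonneg hL'0.le] at hp
      linarith
  refine le_of_forall_pos_le_add fun ε hε => ?_
  have := key (L + ε / (‖y‖ + 1)) (by
    have := norm_nonneg y
    have : 0 < ε / (‖y‖ + 1) := by positivity
    linarith)
  have h2 : ε / (‖y‖ + 1) * ‖y‖ ≤ ε := by
    have := norm_nonneg y
    rw [div_mul_eq_mul_div, div_le_iff₀ (by positivity)]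
    nlinarith
  nlinarith

end ScalarFunctions

/-! ### Maximum principle and oscillation bound for coupling matrices -/

section Matrices

variable {m : ℕ} {A : Matrix (Fin m) (Fin m) ℝ}

/-- Vanishing row sums mean that only differences of components matter; for a coupling matrix the
weights `-A i j` off the diagonal are nonnegative. -/
lemma IsDegenerate.mulVec_eq (hA : IsDegenerate A) (w : Fin m → ℝ) (i : Fin m) :
    (A *ᵥ w) i = ∑ j, -A i j * (w i - w j) := by
  have h : ∑ j, A i j * w i = 0 := by rw [← Finset.sum_mul, hA i, zero_mul]
  calc (A *ᵥ w) i = ∑ j, A i j * w j - ∑ j, A i j * w i := by rw [h, sub_zero]; rfl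
    _ = _ := by rw [← Finset.sum_sub_distrib]; exact Finset.sum_congr rfl fun j _ => by ring

lemma IsDegenerate.mulVec_add_const (hA : IsDegenerate A) (w : Fin m → ℝ) (c : ℝ) (i : Fin m) :
    (A *ᵥ fun j => w j + c) i = (A *ᵥ w) i := by
  simp [hA.mulVec_eq]

lemma IsCoupling.neg_mul_nonneg (hc : IsCoupling A) {w : Fin m → ℝ} {i : Fin m}
    (hw : ∀ j, w j ≤ w i) (j : Fin m) : 0 ≤ -A i j * (w i - w j) := by
  by_cases hj : j = i
  · simp [hj]
  · exact mul_nonneg (neg_nonneg.2 (hc.offDiag_nonpos i j hj)) (sub_nonneg.2 (hw j))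

lemma IsCoupling.mulVec_nonneg (hc : IsCoupling A) (hA : IsDegenerate A) {w : Fin m → ℝ}
    {i : Fin m} (hw : ∀ j, w j ≤ w i) : 0 ≤ (A *ᵥ w) i := by
  rw [hA.mulVec_eq]
  exact Finset.sum_nonneg fun j _ => hc.neg_mul_nonneg hw j

lemma IsCoupling.mulVec_pos (hc : IsCoupling A) (hA : IsDegenerate A) {w : Fin m → ℝ}
    {i j : Fin m} (hw : ∀ j, w j ≤ w i) (hj : w j < w i) (hij : A i j ≠ 0) : 0 < (A *ᵥ w) i := by
  rw [hA.mulVec_eq]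
  refine Finset.sum_pos' (fun j _ => hc.neg_mul_nonneg hw j) ⟨j, Finset.mem_univ j, ?_⟩
  have hne : j ≠ i := fun h => by simp [h] at hj
  exact mul_pos (neg_pos.2 (lt_of_le_of_ne (hc.offDiag_nonpos i j hne) hij)) (sub_pos.2 hj)

/-- Maximum principle for irreducible coupling matrices. -/
lemma IsIrreducible.eq_of_mulVec_nonpos (hi : IsIrreducible A) (hc : IsCoupling A)
    (hA : IsDegenerate A) {w : Fin m → ℝ} {M : ℝ} (hM : ∀ j, w j ≤ M) (hex : ∃ j, w j = M)
    (hw : ∀ i, w i = M → (A *ᵥ w) i ≤ 0) (i : Fin m) : w i = M := by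
  by_contra hne
  obtain ⟨i₀, hi₀, j, hj, hij⟩ := hi {j | w j = M} hex
    (fun h => hne (by have : i ∈ {j | w j = M} := h ▸ mem_univ i
                      exact this))
  rw [mem_ofPred_eq] at hi₀ hj
  have := hc.mulVec_pos hA (w := w) (i := i₀) (j := j) (by rw [hi₀]; exact hM)
    (by rw [hi₀]; exact lt_of_le_of_ne (hM j) hj) hij
  linarith [hw i₀ hi₀]

end Matrices

lemma continuous_mulVec {X : Type*} [TopologicalSpace X] {m : ℕ}
    {B : X → Matrix (Fin m) (Fin m) ℝ} (hB : ∀ i j, Continuous fun x => B x i j)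
    {w : X → Fin m → ℝ} (hw : Continuous w) (i : Fin m) :
    Continuous fun x => (B x *ᵥ w x) i := by
  simp only [Matrix.mulVec, dotProduct]
  exact continuous_finsetSum _ fun j _ => (hB i j).mul ((continuous_apply j).comp hw)

/-- An upper bound on `B(x) w` controls the oscillation of `w`, uniformly in `x`. -/
lemma exists_oscillation_bound {X : Type*} [TopologicalSpace X] [CompactSpace X] {m : ℕ}
    {B : X → Matrix (Fin m) (Fin m) ℝ} (hB : ∀ i j, Continuous fun x => B x i j)
    (hc : ∀ x, IsCoupling (B x)) (hi : ∀ x, IsIrreducible (B x)) (hd : ∀ x, IsDegenerate (B x))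
    (C : ℝ) : ∃ C' : ℝ, 0 ≤ C' ∧ ∀ x (w : Fin m → ℝ), (∀ i, (B x *ᵥ w) i ≤ C) →
      ∀ i j, w i - w j ≤ C' := by
  -- Vectors normalized to have maximum `0` and minimum `-1`. They form a compact set on which, by
  -- the maximum principle, `B(x) w` always has a positive entry; shift and scaling reduce every
  -- nonconstant `w` to this case.
  set S : Set (Fin m → ℝ) := Icc (fun _ => -1) 0 ∩ ((⋃ i, {w | w i = 0}) ∩ ⋃ j, {w | w j = -1})
    with hS
  have hScl : IsClosed ((⋃ i : Fin m, {w : Fin m → ℝ | w i = 0}) ∩ ⋃ j, {w | w j = -1}) :=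
    (isClosed_iUnion_of_finite fun i => isClosed_eq (continuous_apply i) continuous_const).inter
      (isClosed_iUnion_of_finite fun i => isClosed_eq (continuous_apply i) continuous_const)
  have hScpt : IsCompact S := isCompact_Icc.inter_right hScl
  have hfcont : Continuous fun z : X × (Fin m → ℝ) => ∑ i, max ((B z.1 *ᵥ z.2) i) 0 :=
    continuous_finsetSum _ fun i _ =>
      (continuous_mulVec (fun i j => (hB i j).comp continuous_fst) continuous_snd i).max
        continuous_const
  obtain ⟨ε, hε, hεf⟩ := (isCompact_univ.prod hScpt).exists_forall_le' (a := 0)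
    hfcont.continuousOn (by
      rintro ⟨x, w⟩ ⟨-, hw, hw0, hw1⟩
      obtain ⟨i₀, hi₀⟩ := mem_iUnion.1 hw0
      obtain ⟨j₀, hj₀⟩ := mem_iUnion.1 hw1
      simp only [mem_ofPred_eq] at hi₀ hj₀
      by_contra hle
      have hz := (Finset.sum_eq_zero_iff_of_nonneg (fun i _ => le_max_right _ _)).1
        (le_antisymm (not_lt.1 hle) (Finset.sum_nonneg fun i _ => le_max_right _ _))
      have := (hi x).eq_of_mulVec_nonpos (hc x) (hd x) (M := 0) (fun j => hw.2 j) ⟨i₀, hi₀⟩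
        (fun i _ => (le_max_left _ 0).trans (hz i (Finset.mem_univ i)).le) j₀
      exact absurd (hj₀.symm.trans this) (by norm_num))
  refine ⟨m * max C 0 / ε, by positivity, fun x w hw i j => ?_⟩
  have : Nonempty (Fin m) := ⟨i⟩
  obtain ⟨i₀, hi₀⟩ := Finite.exists_max w
  obtain ⟨j₀, hj₀⟩ := Finite.exists_min w
  refine (sub_le_sub (hi₀ i) (hj₀ j)).trans ?_
  rcases (sub_nonneg.2 (hi₀ j₀)).eq_or_lt with h0 | hpos
  · rw [← h0]; positivity
  set o := w i₀ - w j₀ with ho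
  set w' : Fin m → ℝ := fun j => (w j - w i₀) / o with hw'
  have hmem : w' ∈ S := by
    refine ⟨⟨fun j => ?_, fun j => ?_⟩, mem_iUnion.2 ⟨i₀, ?_⟩, mem_iUnion.2 ⟨j₀, ?_⟩⟩
    · rw [hw', le_div_iff₀ hpos]; linarith [hj₀ j]
    · exact div_nonpos_of_nonpos_of_nonneg (sub_nonpos.2 (hi₀ j)) hpos.le
    · simp [hw']
    · simp only [mem_ofPred_eq, hw']
      rw [div_eq_iff hpos.ne']; linarith
  have hle := hεf (x, w') ⟨mem_univ _, hmem⟩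
  have hterm : ∀ i, (B x *ᵥ w') i = (B x *ᵥ w) i / o := fun i => by
    rw [(hd x).mulVec_eq, (hd x).mulVec_eq, Finset.sum_div]
    refine Finset.sum_congr rfl fun j _ => ?_
    simp only [hw']
    field_simp
    ring
  have hsum : ∑ i, max ((B x *ᵥ w') i) 0 ≤ ∑ _i : Fin m, max C 0 / o :=
    Finset.sum_le_sum fun i _ => by
      refine max_le ?_ (by positivity)
      rw [hterm]
      exact div_le_div_of_nonneg_right ((hw i).trans (le_max_left _ _)) hpos.le
  have hfin : ε ≤ m * max C 0 / o := by
    refine hle.trans (hsum.trans_eq ?_)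
    rw [Finset.sum_const, Finset.card_univ, Fintype.card_fin, nsmul_eq_mul, mul_div_assoc]
  rw [le_div_iff₀ hpos] at hfin
  rw [le_div_iff₀ hε]
  linarith

/-! ### A priori bounds for subsolutions -/

section Subsolutions

variable {N m : ℕ} {H : Fin m → Torus N → Momentum N → ℝ}
  {B : Torus N → Matrix (Fin m) (Fin m) ℝ}

/-- At points with a supergradient the equation gives the bound; such points are dense and both
sides are continuous. -/
lemma IsSubsolution.mulVec_le (hB : ∀ i j, Continuous fun x => B x i j) {a : ℝ}
    {u : Torus N → Fin m → ℝ} (hu : IsSubsolution H B a u) {i : Fin m} {μ : ℝ}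
    (hμ : ∀ x p, μ ≤ H i x p) (x : Torus N) : (B x *ᵥ u x) i ≤ a - μ := by
  by_contra hlt
  have hcont := continuous_mulVec hB hu.continuous i
  obtain ⟨y, ⟨p, hp⟩, hy⟩ := ((frequently_superdifferential_nonempty
    ((continuous_apply i).comp hu.continuous) x).and_eventually
      (hcont.continuousAt.eventually_const_lt (not_le.1 hlt))).exists
  linarith [hu.le y i p hp, hμ y p]

/-- Subsolutions are equi-Lipschitz and have uniformly bounded oscillation. -/
lemma exists_equi_bounds (hH : ∀ i, IsConvexHamiltonian (H i))
    (hB : ∀ i j, Continuous fun x => B x i j) (hc : ∀ x, IsCoupling (B x))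
    (hi : ∀ x, IsIrreducible (B x)) (hd : ∀ x, IsDegenerate (B x)) (a : ℝ) :
    ∃ L C : ℝ, 0 ≤ L ∧ ∀ u, IsSubsolution H B a u →
      (∀ i, ChartLipschitz L fun x => u x i) ∧ ∀ x y i j, u x i - u y j ≤ C := by
  choose μ hμ using fun i => (hH i).exists_lower_bound
  -- The upper bound on `B u` controls the oscillation among components, hence also bounds `B u`
  -- from below. The equation then bounds the Hamiltonian on supergradients, and coercivity bounds
  -- the supergradients themselves.
  obtain ⟨C₁, hC₁0, hC₁⟩ := exists_oscillation_bound hB hc hi hd (∑ i, |a - μ i|)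
  have hosc : ∀ u, IsSubsolution H B a u → ∀ x i j, u x i - u x j ≤ C₁ := fun u hu x =>
    hC₁ x (u x) fun i => (hu.mulVec_le hB (hμ i) x).trans ((le_abs_self _).trans
      (Finset.single_le_sum (f := fun i => |a - μ i|) (fun _ _ => abs_nonneg _)
        (Finset.mem_univ i)))
  choose R hR0 hR using fun i => exists_forall_abs_le
    (continuous_finsetSum Finset.univ fun j _ => (hB i j).abs : Continuous fun x => ∑ j, |B x i j|)
  choose L hL0 hL using fun i => (hH i).exists_norm_le (a + R i * C₁)
  have hBu : ∀ u, IsSubsolution H B a u → ∀ x i, -(R i * C₁) ≤ (B x *ᵥ u x) i := by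
    intro u hu x i
    rw [(hd x).mulVec_eq]
    have h1 : |∑ j, -B x i j * (u x i - u x j)| ≤ ∑ j, |B x i j| * C₁ := by
      refine (Finset.abs_sum_le_sum_abs _ _).trans (Finset.sum_le_sum fun j _ => ?_)
      rw [abs_mul, abs_neg]
      exact mul_le_mul_of_nonneg_left (abs_sub_le_iff.2 ⟨hosc u hu x i j, hosc u hu x j i⟩)
        (abs_nonneg _)
    rw [← Finset.sum_mul] at h1
    have h2 := mul_le_mul_of_nonneg_right ((le_abs_self _).trans (hR i x)) hC₁0
    linarith [(abs_le.1 h1).1]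
  have hLip : ∀ u, IsSubsolution H B a u → ∀ i, ChartLipschitz (∑ i, L i) fun x => u x i := by
    intro u hu i
    refine chartLipschitz_of_superdifferential ((continuous_apply i).comp hu.continuous)
      (Finset.sum_nonneg fun i _ => hL0 i) fun x p hp => ?_
    refine (hL i x p ?_).trans (Finset.single_le_sum (fun i _ => hL0 i) (Finset.mem_univ i))
    linarith [hu.le x i p hp, hBu u hu x i]
  have hLs : 0 ≤ ∑ i, L i := Finset.sum_nonneg fun i _ => hL0 i
  refine ⟨∑ i, L i, (∑ i, L i) * √N + C₁, hLs, fun u hu =>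
    ⟨hLip u hu, fun x y i j => ?_⟩⟩
  obtain ⟨h, hh, rfl⟩ := exists_translate_eq y x
  have h1 := hLip u hu i y h
  have h2 := hosc u hu y i j
  have h3 := mul_le_mul_of_nonneg_left hh hLs
  simp only at h1
  linarith

end Subsolutions

/-! ### Doubling of variables -/

/-- The inequality yields `n d ≤ L` and `n ζ² ≤ L²`: a large `n` localizes the maximum points while
the gradient of the penalty stays bounded independently of `n`. -/
lemma exists_penalization {L r : ℝ} (hL : 0 ≤ L) (hr : 0 < r) :
    ∃ n : ℝ, 0 < n ∧ ∀ ζ d : ℝ, 0 ≤ ζ → 0 ≤ d → ζ ^ 2 + n * d ^ 2 ≤ L * d →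
      ζ + d < r ∧ n * d ≤ L := by
  have h1 : 0 ≤ 2 * L / r := by positivity
  have h2 : 0 ≤ 4 * L ^ 2 / r ^ 2 := by positivity
  -- The second term gives `d < r / 2`, the third `ζ < r / 2`; the leading `1` makes both strict.
  set n : ℝ := 1 + 2 * L / r + 4 * L ^ 2 / r ^ 2 with hn
  have hn0 : 0 < n := by positivity
  refine ⟨n, hn0, fun ζ d hζ hd h => ?_⟩
  have hnd : n * d ≤ L := by
    rcases hd.eq_or_lt with rfl | hd
    · simpa using hL
    · have : (n * d) * d ≤ L * d := by nlinarith [sq_nonneg ζ]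
      exact le_of_mul_le_mul_right this hd
  have hr1 : L < n * (r / 2) := by
    have : n * (r / 2) = r / 2 + L + 2 * L ^ 2 / r := by rw [hn]; field_simp; ring
    have : 0 ≤ 2 * L ^ 2 / r := by positivity
    linarith
  have hr2 : L ^ 2 < n * (r / 2) ^ 2 := by
    have : n * (r / 2) ^ 2 = r ^ 2 / 4 + L * r / 2 + L ^ 2 := by rw [hn]; field_simp; ring
    have : 0 < r ^ 2 / 4 := by positivity
    have : 0 ≤ L * r / 2 := by positivity
    linarith
  have hd1 : d < r / 2 := lt_of_mul_lt_mul_left (hnd.trans_lt hr1) hn0.le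
  have hζ1 : ζ < r / 2 := by
    refine lt_of_pow_lt_pow_left₀ 2 (by positivity) (lt_of_mul_lt_mul_left ?_ hn0.le)
    have h3 : n * ζ ^ 2 ≤ L * (n * d) := by
      have := mul_le_mul_of_nonneg_left h hn0.le
      nlinarith [sq_nonneg (n * d)]
    nlinarith
  exact ⟨by linarith, hnd⟩

section Doubling

variable {N : ℕ} {H : Torus N → Momentum N → ℝ} {f g F G : Torus N → ℝ} {x₀ : Torus N} {L : ℝ}

/-- Freeze the other variable and divide by `s`. The factor `s` from the chain rule in `θ (s • x +
w)` cancels, so `P` enters unscaled. -/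
lemma mem_superdifferential_of_penalized {θ : Momentum N → ℝ} {x y w P : Momentum N} {s n : ℝ}
    (hs : 0 < s) (hθ : IsC1WithGradient θ P (s • x + w))
    (hmax : ∀ᶠ x' in 𝓝 x, s * f (translate x₀ x') - θ (s • x' + w) - n * ‖x' - y‖ ^ 2 ≤
      s * f (translate x₀ x) - θ (s • x + w) - n * ‖x - y‖ ^ 2) :
    P + s⁻¹ • ((2 * n) • (x - y)) ∈ superdifferential f (translate x₀ x) := by
  have h1 := ((hθ.comp_affine).add ((IsC1WithGradient.norm_sub_sq y x).const_mul n)).const_mul s⁻¹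
  have h2 : s⁻¹ • (s • P + n • (2 : ℝ) • (x - y)) = P + s⁻¹ • ((2 * n) • (x - y)) := by
    rw [smul_add, smul_smul, inv_mul_cancel₀ hs.ne', one_smul, smul_smul n, mul_comm n]
  rw [h2] at h1
  refine mem_superdifferential_of_chart h1 ?_
  filter_upwards [hmax] with x' hx'
  have h3 : ∀ A T : ℝ, A - s⁻¹ * T = s⁻¹ * (s * A - T) := fun A T => by
    field_simp
  rw [h3, h3]
  refine mul_le_mul_of_nonneg_left ?_ (by positivity)
  linarith

/-- A supergradient of a sum need not split, so the variables are doubled. Testing with a function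
of `s • x + t • y` gives both factors the same main momentum, and the penalty contributes opposite
corrections that cancel in the `s`, `t` average. The added square of the norm forces the maximum
points towards `0`. -/
lemma ChartLipschitz.doubling_convexComb {φ : Momentum N → ℝ} (hL : 0 ≤ L)
    (hf : ChartLipschitz L f) (hg : ChartLipschitz L g) {s t : ℝ} (hs : 0 < s) (ht : 0 < t)
    (hst : s + t = 1) (hφ : ContDiffAt ℝ 1 φ 0)
    (hmax : IsLocalMax (fun h => (s * f (translate x₀ h) + t * g (translate x₀ h)) - φ h) 0)
    {ε : ℝ} (hε : 0 < ε) :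
    ∃ x y z q : Momentum N, ‖x‖ < ε ∧ ‖y‖ < ε ∧ ‖z‖ < ε ∧ ‖q‖ ≤ 2 * L ∧
      (gradient φ z + (2 : ℝ) • z) + s⁻¹ • q ∈ superdifferential f (translate x₀ x) ∧
      (gradient φ z + (2 : ℝ) • z) + t⁻¹ • (-q) ∈ superdifferential g (translate x₀ y) := by
  obtain ⟨r₀, hr₀, hball⟩ := Metric.eventually_nhds_iff_ball.1
    ((IsC1WithGradient.eventually hφ).and hmax)
  set r : ℝ := min ε r₀ / 2 with hr
  have hrpos : 0 < r := by positivity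
  have hrε : r < ε := by have := min_le_left ε r₀; rw [hr]; linarith
  have hrr : r < r₀ := by have := min_le_right ε r₀; rw [hr]; linarith
  have hsub : ∀ z : Momentum N, ‖z‖ ≤ r → z ∈ Metric.ball (0 : Momentum N) r₀ := fun z hz => by
    simpa using hz.trans_lt hrr
  obtain ⟨n, hn, hpen⟩ := exists_penalization hL hrpos
  have hcomb : ∀ x y : Momentum N, ‖x‖ ≤ r → ‖y‖ ≤ r → ‖s • x + t • y‖ ≤ r := by
    intro x y hx hy
    calc ‖s • x + t • y‖ ≤ s * ‖x‖ + t * ‖y‖ := by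
          refine (norm_add_le _ _).trans_eq ?_
          rw [norm_smul, norm_smul, Real.norm_of_nonneg hs.le, Real.norm_of_nonneg ht.le]
      _ ≤ s * r + t * r := by gcongr
      _ = r := by rw [← add_mul, hst, one_mul]
  set θ : Momentum N → ℝ := fun z => φ z + ‖z‖ ^ 2 with hθ
  have hθC : ∀ z, ‖z‖ ≤ r → IsC1WithGradient θ (gradient φ z + (2 : ℝ) • z) z := fun z hz =>
    (hball z (hsub z hz)).1.add (IsC1WithGradient.norm_sq z)
  set Ψ : Momentum N × Momentum N → ℝ := fun z =>
    s * f (translate x₀ z.1) + t * g (translate x₀ z.2) - θ (s • z.1 + t • z.2)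
      - n * ‖z.1 - z.2‖ ^ 2 with hΨ
  have hfc := hf.continuous.comp (continuous_translate x₀)
  have hgc := hg.continuous.comp (continuous_translate x₀)
  have hΨc : ContinuousOn Ψ (Metric.closedBall 0 r ×ˢ Metric.closedBall 0 r) := by
    refine ContinuousOn.sub (ContinuousOn.sub (Continuous.continuousOn ?_) ?_)
      (Continuous.continuousOn (by fun_prop))
    · exact ((hfc.comp continuous_fst).const_mul s).add ((hgc.comp continuous_snd).const_mul t)
    · have h1 : ContinuousOn θ (Metric.closedBall 0 r) := fun z hz =>
        (hθC z (by simpa using hz)).1.continuousAt.continuousWithinAt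
      refine h1.comp (f := fun z : Momentum N × Momentum N => s • z.1 + t • z.2)
        (Continuous.continuousOn (by fun_prop)) ?_
      rintro ⟨x, y⟩ ⟨hx, hy⟩
      simpa using hcomb x y (by simpa using hx) (by simpa using hy)
  obtain ⟨⟨x, y⟩, ⟨hx, hy⟩, hxy⟩ := ((isCompact_closedBall (0 : Momentum N) r).prod
    (isCompact_closedBall (0 : Momentum N) r)).exists_isMaxOn
      ⟨(0, 0), by simp [hrpos.le]⟩ hΨc
  have hxr : ‖x‖ ≤ r := by simpa using hx
  have hyr : ‖y‖ ≤ r := by simpa using hy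
  have hmaxΨ : ∀ x' y' : Momentum N, ‖x'‖ ≤ r → ‖y'‖ ≤ r → Ψ (x', y') ≤ Ψ (x, y) :=
    fun x' y' hx' hy' => hxy ⟨by simpa using hx', by simpa using hy'⟩
  set z := s • x + t • y with hz
  have hzr := hcomb x y hxr hyr
  have hxz : x - z = t • (x - y) := by
    rw [hz, eq_sub_of_add_eq hst]; module
  have hyz : y - z = -(s • (x - y)) := by
    rw [hz, eq_sub_of_add_eq' hst]; module
  -- Compare the maximum with the value at `(0, 0)`: moving `x` and `y` to their barycentre `z`
  -- costs at most `L * ‖x - y‖`, and at `z` the original local maximum applies.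
  have hbound : ‖z‖ ^ 2 + n * ‖x - y‖ ^ 2 ≤ L * ‖x - y‖ := by
    have h0 := hmaxΨ 0 0 (by simpa using hrpos.le) (by simpa using hrpos.le)
    have h1 := (hball z (hsub z hzr)).2
    have h2 := hf.le_add x₀ x z
    have h3 := hg.le_add x₀ y z
    rw [hxz, norm_smul, Real.norm_of_nonneg ht.le] at h2
    rw [hyz, norm_neg, norm_smul, Real.norm_of_nonneg hs.le] at h3
    simp only [hΨ, hθ, smul_zero, add_zero, sub_self, norm_zero, ← hz] at h0
    have h4 := mul_le_mul_of_nonneg_left h2 hs.le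
    have h5 := mul_le_mul_of_nonneg_left h3 ht.le
    have h6 : s * (L * (t * ‖x - y‖)) + t * (L * (s * ‖x - y‖)) ≤ L * ‖x - y‖ := by
      have h7 : 0 ≤ L * ‖x - y‖ := by positivity
      have h8 : s * t + t * s ≤ 1 := by nlinarith [sq_nonneg (s - t)]
      nlinarith
    nlinarith
  obtain ⟨hlt, hnd⟩ := hpen _ _ (norm_nonneg z) (norm_nonneg (x - y)) hbound
  have hst1 : s ≤ 1 := by linarith
  have hst2 : t ≤ 1 := by linarith
  have hxlt : ‖x‖ < r := by
    have h1 : x = z + t • (x - y) := by rw [← hxz]; abel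
    have h2 : ‖x‖ ≤ ‖z‖ + t * ‖x - y‖ := by
      conv_lhs => rw [h1]
      refine (norm_add_le _ _).trans_eq ?_
      rw [norm_smul, Real.norm_of_nonneg ht.le]
    nlinarith [norm_nonneg (x - y)]
  have hylt : ‖y‖ < r := by
    have h1 : y = z + -(s • (x - y)) := by rw [← hyz]; abel
    have h2 : ‖y‖ ≤ ‖z‖ + s * ‖x - y‖ := by
      conv_lhs => rw [h1]
      refine (norm_add_le _ _).trans_eq ?_
      rw [norm_neg, norm_smul, Real.norm_of_nonneg hs.le]
    nlinarith [norm_nonneg (x - y)]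
  refine ⟨x, y, z, (2 * n) • (x - y), by linarith, by linarith, by linarith, ?_, ?_, ?_⟩
  · rw [norm_smul, Real.norm_of_nonneg (by positivity)]
    linarith
  · refine mem_superdifferential_of_penalized (θ := θ) (w := t • y) hs (hθC z hzr) ?_
    filter_upwards [Metric.isOpen_ball.mem_nhds (show x ∈ Metric.ball 0 r by simpa using hxlt)]
      with x' hx'
    have := hmaxΨ x' y (by simpa using (mem_ball_zero_iff.1 hx').le) hyr
    simp only [hΨ] at this
    linarith
  · rw [← smul_neg, neg_sub]
    refine mem_superdifferential_of_penalized (θ := θ) (w := s • x) ht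
      (by rw [add_comm (t • y)]; exact hθC z hzr) ?_
    filter_upwards [Metric.isOpen_ball.mem_nhds (show y ∈ Metric.ball 0 r by simpa using hylt)]
      with y' hy'
    have := hmaxΨ x y' hxr (by simpa using (mem_ball_zero_iff.1 hy').le)
    simp only [hΨ] at this
    rw [norm_sub_rev y' x, norm_sub_rev y x, add_comm (t • y'), add_comm (t • y)]
    linarith

/-- Convex combinations of Lipschitz viscosity subsolutions are viscosity subsolutions. -/
lemma IsConvexHamiltonian.le_of_mem_superdifferential_convexComb (hH : IsConvexHamiltonian H)
    (hL : 0 ≤ L) (hf : ChartLipschitz L f) (hg : ChartLipschitz L g) (hF : Continuous F)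
    (hG : Continuous G) {s t : ℝ} (hs : 0 < s) (ht : 0 < t) (hst : s + t = 1)
    (hfF : ∀ᶠ x in 𝓝 x₀, ∀ p ∈ superdifferential f x, H x p ≤ F x)
    (hgG : ∀ᶠ x in 𝓝 x₀, ∀ p ∈ superdifferential g x, H x p ≤ G x) {p : Momentum N}
    (hp : p ∈ superdifferential (fun x => s * f x + t * g x) x₀) :
    H x₀ p ≤ s * F x₀ + t * G x₀ := by
  obtain ⟨φ, hφ, hmax, hgrad⟩ := hp
  choose x y z q hx hy hz hq hxs hys using fun k : ℕ =>
    hf.doubling_convexComb hL hg hs ht hst hφ hmax (Nat.one_div_pos_of_nat (α := ℝ) (n := k))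
  have hto : ∀ w : ℕ → Momentum N, (∀ k : ℕ, ‖w k‖ < 1 / ((k : ℝ) + 1)) →
      Tendsto w atTop (𝓝 0) := fun w hw =>
    squeeze_zero_norm (fun k => (hw k).le) tendsto_one_div_add_atTop_nhds_zero_nat
  obtain ⟨q₀, -, κ, hκ, hq₀⟩ := tendsto_subseq_of_bounded
    (Metric.isBounded_closedBall (x := (0 : Momentum N)) (r := 2 * L))
    (x := q) (fun k => by simpa using hq k)
  have hxκ := (tendsto_translate x₀).comp ((hto x hx).comp hκ.tendsto_atTop)
  have hyκ := (tendsto_translate x₀).comp ((hto y hy).comp hκ.tendsto_atTop)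
  have hzκ := (hto z hz).comp hκ.tendsto_atTop
  have hP : Tendsto (fun k => gradient φ (z (κ k)) + (2 : ℝ) • z (κ k)) atTop (𝓝 p) := by
    have := ((IsC1WithGradient.tendsto_gradient ⟨hφ, hgrad⟩).comp hzκ).add
      (hzκ.const_smul (2 : ℝ))
    simpa using this
  have h1 : H x₀ (p + s⁻¹ • q₀) ≤ F x₀ := by
    refine le_of_tendsto_of_tendsto (hH.tendsto hxκ (hP.add (hq₀.const_smul s⁻¹)))
      ((hF.tendsto x₀).comp hxκ) ?_
    filter_upwards [hxκ.eventually hfF] with k hk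
    exact hk _ (hxs (κ k))
  have h2 : H x₀ (p + t⁻¹ • (-q₀)) ≤ G x₀ := by
    refine le_of_tendsto_of_tendsto (hH.tendsto hyκ (hP.add (hq₀.neg.const_smul t⁻¹)))
      ((hG.tendsto x₀).comp hyκ) ?_
    filter_upwards [hyκ.eventually hgG] with k hk
    exact hk _ (hys (κ k))
  -- In the limit the two momenta average exactly to `p`, so convexity of the Hamiltonian combines
  -- the two inequalities.
  have h3 := (hH.convex x₀).2 (mem_univ (p + s⁻¹ • q₀)) (mem_univ (p + t⁻¹ • (-q₀))) hs.le ht.le hst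
  have h4 : s • (p + s⁻¹ • q₀) + t • (p + t⁻¹ • (-q₀)) = p := by
    rw [smul_add, smul_add, smul_smul, smul_smul, mul_inv_cancel₀ hs.ne', mul_inv_cancel₀ ht.ne']
    calc _ = (s + t) • p := by module
      _ = p := by rw [hst, one_smul]
  rw [h4, smul_eq_mul, smul_eq_mul] at h3
  have h5 := mul_le_mul_of_nonneg_left h1 hs.le
  have h6 := mul_le_mul_of_nonneg_left h2 ht.le
  linarith

/-- Only `f` is moved, from `x` to `y`, so continuity of `g` suffices. The two momenta differ by
`2x`, which vanishes in the limit. -/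
lemma ChartLipschitz.doubling_comparison (hL : 0 ≤ L) (hf : ChartLipschitz L f)
    (hg : Continuous g) (hmax : IsLocalMax (fun x => f x - g x) x₀) {ε : ℝ} (hε : 0 < ε) :
    ∃ x y q : Momentum N, ‖x‖ < ε ∧ ‖y‖ < ε ∧ ‖q‖ ≤ 2 * L ∧
      (2 : ℝ) • x + q ∈ superdifferential f (translate x₀ x) ∧
      q ∈ subdifferential g (translate x₀ y) := by
  rw [IsLocalMax, IsMaxFilter, ← map_translate_nhds_zero x₀, eventually_map] at hmax
  obtain ⟨r₀, hr₀, hball⟩ := Metric.eventually_nhds_iff_ball.1 hmax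
  set r : ℝ := min ε r₀ / 2 with hr
  have hrpos : 0 < r := by positivity
  have hrε : r < ε := by have := min_le_left ε r₀; rw [hr]; linarith
  have hrr : r < r₀ := by have := min_le_right ε r₀; rw [hr]; linarith
  obtain ⟨n, hn, hpen⟩ := exists_penalization hL hrpos
  set Ψ : Momentum N × Momentum N → ℝ := fun z =>
    f (translate x₀ z.1) - g (translate x₀ z.2) - ‖z.1‖ ^ 2 - n * ‖z.1 - z.2‖ ^ 2 with hΨ
  have hΨc : Continuous Ψ := by
    have hfc := (hf.continuous.comp (continuous_translate x₀)).comp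
      (continuous_fst (X := Momentum N) (Y := Momentum N))
    have hgc := (hg.comp (continuous_translate x₀)).comp
      (continuous_snd (X := Momentum N) (Y := Momentum N))
    exact ((hfc.sub hgc).sub (by fun_prop)).sub (by fun_prop)
  obtain ⟨⟨x, y⟩, ⟨hx, hy⟩, hxy⟩ := ((isCompact_closedBall (0 : Momentum N) r).prod
    (isCompact_closedBall (0 : Momentum N) r)).exists_isMaxOn
      ⟨(0, 0), by simp [hrpos.le]⟩ hΨc.continuousOn
  have hxr : ‖x‖ ≤ r := by simpa using hx
  have hyr : ‖y‖ ≤ r := by simpa using hy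
  have hmaxΨ : ∀ x' y' : Momentum N, ‖x'‖ ≤ r → ‖y'‖ ≤ r → Ψ (x', y') ≤ Ψ (x, y) :=
    fun x' y' hx' hy' => hxy ⟨by simpa using hx', by simpa using hy'⟩
  have hbound : ‖x‖ ^ 2 + n * ‖x - y‖ ^ 2 ≤ L * ‖x - y‖ := by
    have h0 := hmaxΨ 0 0 (by simpa using hrpos.le) (by simpa using hrpos.le)
    have h1 := hball y (by simpa using hyr.trans_lt hrr)
    have h2 := hf.le_add x₀ x y
    simp only [hΨ, sub_self, norm_zero, translate_zero] at h0
    linarith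
  obtain ⟨hlt, hnd⟩ := hpen _ _ (norm_nonneg x) (norm_nonneg (x - y)) hbound
  have hxlt : ‖x‖ < r := by linarith [norm_nonneg (x - y)]
  have hylt : ‖y‖ < r := by
    have h2 : ‖y‖ ≤ ‖x‖ + ‖x - y‖ := by
      rw [norm_sub_rev x y]
      simpa using norm_add_le x (y - x)
    linarith
  refine ⟨x, y, (2 * n) • (x - y), by linarith, by linarith, ?_, ?_, ?_⟩
  · rw [norm_smul, Real.norm_of_nonneg (by positivity)]
    linarith
  · have h1 := mem_superdifferential_of_penalized (f := f) (x₀ := x₀) (θ := fun z => ‖z‖ ^ 2)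
      (w := 0) (x := x) (y := y) (s := 1) (n := n) (P := (2 : ℝ) • x) one_pos
      (by simpa using IsC1WithGradient.norm_sq x) ?_
    · simpa using h1
    filter_upwards [Metric.isOpen_ball.mem_nhds (show x ∈ Metric.ball 0 r by simpa using hxlt)]
      with x' hx'
    have := hmaxΨ x' y (by simpa using (mem_ball_zero_iff.1 hx').le) hyr
    simp only [hΨ] at this
    simp only [one_smul, add_zero]
    linarith
  · have h1 := (IsC1WithGradient.norm_sub_sq x y).const_mul (-n)
    have h2 : (-n) • (2 : ℝ) • (y - x) = (2 * n) • (x - y) := by module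
    rw [h2] at h1
    refine mem_subdifferential_of_chart h1 ?_
    filter_upwards [Metric.isOpen_ball.mem_nhds (show y ∈ Metric.ball 0 r by simpa using hylt)]
      with y' hy'
    have := hmaxΨ x y' hxr (by simpa using (mem_ball_zero_iff.1 hy').le)
    simp only [hΨ] at this
    rw [norm_sub_rev y' x, norm_sub_rev y x]
    linarith

/-- At a local maximum of the difference of a Lipschitz subsolution and a supersolution, the
right-hand sides are ordered. -/
lemma IsConvexHamiltonian.le_of_isLocalMax_sub (hH : IsConvexHamiltonian H) (hL : 0 ≤ L)
    (hf : ChartLipschitz L f) (hg : Continuous g) (hF : Continuous F) (hG : Continuous G)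
    (hfF : ∀ᶠ x in 𝓝 x₀, ∀ p ∈ superdifferential f x, H x p ≤ F x)
    (hgG : ∀ᶠ x in 𝓝 x₀, ∀ p ∈ subdifferential g x, G x ≤ H x p)
    (hmax : IsLocalMax (fun x => f x - g x) x₀) : G x₀ ≤ F x₀ := by
  choose x y q hx hy hq hxs hys using fun k : ℕ =>
    hf.doubling_comparison hL hg hmax (Nat.one_div_pos_of_nat (α := ℝ) (n := k))
  have hto : ∀ w : ℕ → Momentum N, (∀ k : ℕ, ‖w k‖ < 1 / ((k : ℝ) + 1)) →
      Tendsto w atTop (𝓝 0) := fun w hw =>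
    squeeze_zero_norm (fun k => (hw k).le) tendsto_one_div_add_atTop_nhds_zero_nat
  obtain ⟨q₀, -, κ, hκ, hq₀⟩ := tendsto_subseq_of_bounded
    (Metric.isBounded_closedBall (x := (0 : Momentum N)) (r := 2 * L))
    (x := q) (fun k => by simpa using hq k)
  have hxκ := (hto x hx).comp hκ.tendsto_atTop
  have hxκ' := (tendsto_translate x₀).comp hxκ
  have hyκ := (tendsto_translate x₀).comp ((hto y hy).comp hκ.tendsto_atTop)
  have hP : Tendsto (fun k => (2 : ℝ) • x (κ k) + q (κ k)) atTop (𝓝 q₀) := by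
    simpa using (hxκ.const_smul (2 : ℝ)).add hq₀
  have h1 : H x₀ q₀ ≤ F x₀ := by
    refine le_of_tendsto_of_tendsto (hH.tendsto hxκ' hP) ((hF.tendsto x₀).comp hxκ') ?_
    filter_upwards [hxκ'.eventually hfF] with k hk
    exact hk _ (hxs (κ k))
  have h2 : G x₀ ≤ H x₀ q₀ := by
    refine le_of_tendsto_of_tendsto ((hG.tendsto x₀).comp hyκ) (hH.tendsto hyκ hq₀) ?_
    filter_upwards [hyκ.eventually hgG] with k hk
    exact hk _ (hys (κ k))
  exact h2.trans h1

end Doubling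

lemma superdifferential_subset_of_le {N : ℕ} {u v : Torus N → ℝ} {x : Torus N}
    (h : ∀ᶠ y in 𝓝 x, u y ≤ v y) (hx : u x = v x) :
    superdifferential v x ⊆ superdifferential u x := by
  rintro p ⟨φ, h1, h2, h3⟩
  refine ⟨φ, h1, ?_, h3⟩
  filter_upwards [h2, (tendsto_translate x).eventually h] with y hy hy'
  rw [translate_zero] at hy ⊢
  linarith

/-- If a `C¹` function touches `u` from below, then its gradient is the only supergradient. -/
lemma eq_of_mem_superdifferential_of_le {N : ℕ} {u : Torus N → ℝ} {x : Torus N}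
    {θ : Momentum N → ℝ} {z p q : Momentum N} (hθ : IsC1WithGradient θ q z)
    (hle : ∀ᶠ h in 𝓝 z, θ h ≤ u (translate x h)) (heq : θ z = u (translate x z))
    (hp : p ∈ superdifferential u (translate x z)) : p = q := by
  obtain ⟨φ, h1, h2, h3⟩ := hp
  have hθ' : IsC1WithGradient (fun h => θ (h + z)) q 0 := by
    simpa using IsC1WithGradient.comp_affine (φ := θ) (s := 1) (w := z) (z := 0) (p := q)
      (by simpa using hθ)
  have ht : Tendsto (fun h : Momentum N => h + z) (𝓝 0) (𝓝 z) := by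
    simpa using (tendsto_id (x := 𝓝 (0 : Momentum N))).add_const z
  have hmax : IsLocalMax (fun h => θ (h + z) - φ h) 0 := by
    filter_upwards [h2, ht.eventually hle] with h hh hh'
    rw [translate_translate, translate_translate, add_zero, add_comm z h] at hh
    simp only [zero_add]
    linarith
  have h4 := hmax.hasFDerivAt_eq_zero (hθ'.2.hasFDerivAt.sub h3.hasFDerivAt)
  rw [← map_sub, LinearIsometryEquiv.map_eq_zero_iff, sub_eq_zero] at h4
  exact h4.symm

/-! ### Suprema of subsolutions -/

section Suprema

variable {N m : ℕ} {H : Fin m → Torus N → Momentum N → ℝ}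
  {B : Torus N → Matrix (Fin m) (Fin m) ℝ} {a : ℝ}

lemma IsCoupling.diag_nonneg {A : Matrix (Fin m) (Fin m) ℝ} (hA : IsCoupling A) (i : Fin m) :
    0 ≤ A i i := by
  have h1 := hA.rowSum_nonneg i
  rw [← Finset.add_sum_erase _ _ (Finset.mem_univ i)] at h1
  have h2 : ∑ j ∈ Finset.univ.erase i, A i j ≤ 0 :=
    Finset.sum_nonpos fun j hj => hA.offDiag_nonpos i j (Finset.ne_of_mem_erase hj)
  linarith

/-- Raising the other components can only lower row `i`; the diagonal term alone has to be accounted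
for. -/
lemma IsCoupling.mulVec_add_le {A : Matrix (Fin m) (Fin m) ℝ} (hA : IsCoupling A)
    {v w : Fin m → ℝ} (h : ∀ j, v j ≤ w j) (i : Fin m) :
    (A *ᵥ w) i + A i i * (v i - w i) ≤ (A *ᵥ v) i := by
  have h1 : (A *ᵥ v) i - (A *ᵥ w) i = ∑ j, A i j * (v j - w j) := by
    simp only [Matrix.mulVec, dotProduct, ← Finset.sum_sub_distrib, mul_sub]
  rw [← Finset.add_sum_erase _ _ (Finset.mem_univ i)] at h1
  have h2 : 0 ≤ ∑ j ∈ Finset.univ.erase i, A i j * (v j - w j) :=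
    Finset.sum_nonneg fun j hj => mul_nonneg_of_nonpos_of_nonpos
      (hA.offDiag_nonpos i j (Finset.ne_of_mem_erase hj)) (sub_nonpos.2 (h j))
  linarith

lemma IsSubsolution.add_const (hd : ∀ x, IsDegenerate (B x)) {u : Torus N → Fin m → ℝ}
    (hu : IsSubsolution H B a u) (c : ℝ) : IsSubsolution H B a fun x i => u x i + c := by
  refine ⟨continuous_pi fun i => ((continuous_apply i).comp hu.continuous).add continuous_const,
    fun x i p hp => ?_⟩
  rw [(hd x).mulVec_add_const]
  exact hu.le x i p (superdifferential_add_const c x hp)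

/-- The supremum of an equi-Lipschitz family of subsolutions is a subsolution. -/
lemma isSubsolution_of_isLUB (hH : ∀ i, IsConvexHamiltonian (H i))
    (hB : ∀ i j, Continuous fun x => B x i j) (hc : ∀ x, IsCoupling (B x))
    {𝓕 : Set (Torus N → Fin m → ℝ)} {L : ℝ} (h𝓕 : ∀ v ∈ 𝓕, IsSubsolution H B a v)
    (hLip : ∀ v ∈ 𝓕, ∀ i, ChartLipschitz L fun x => v x i) {w : Torus N → Fin m → ℝ}
    (hw : ∀ x i, IsLUB {r | ∃ v ∈ 𝓕, r = v x i} (w x i)) : IsSubsolution H B a w := by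
  have hwLip : ∀ i, ChartLipschitz L fun x => w x i := by
    intro i x h
    refine (hw (translate x h) i).2 ?_
    rintro r ⟨v, hv, rfl⟩
    have h1 := hLip v hv i x h
    have h2 := (hw x i).1 ⟨v, hv, rfl⟩
    simp only at h1 ⊢
    linarith
  have hwc : Continuous w := continuous_pi fun i => (hwLip i).continuous
  refine ⟨hwc, fun x i p => ?_⟩
  rintro ⟨φ, hφ, hmax, hgrad⟩
  obtain ⟨r₀, hr₀, hball⟩ := Metric.eventually_nhds_iff_ball.1
    ((IsC1WithGradient.eventually hφ).and hmax)
  have key : ∀ ε > 0, ∃ h : Momentum N, ‖h‖ < ε ∧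
      H i (translate x h) (gradient φ h + (2 : ℝ) • h) +
        ((B (translate x h) *ᵥ w (translate x h)) i + B (translate x h) i i *
          (w x i - ε + (φ h - φ 0) - w (translate x h) i)) ≤ a := by
    intro ε hε
    set r : ℝ := min ε r₀ / 2 with hr
    have hrpos : 0 < r := by positivity
    have hrε : r < ε := by have := min_le_left ε r₀; rw [hr]; linarith
    have hrr : r < r₀ := by have := min_le_right ε r₀; rw [hr]; linarith
    -- A gap below `r²` keeps the maximum of `v - φ - ‖·‖²` inside the open ball; a gap below `ε`
    -- bounds the error in the diagonal coupling term.
    obtain ⟨_, ⟨v, hv, rfl⟩, hvw, -⟩ := (hw x i).exists_between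
      (show w x i - min (r ^ 2) ε < w x i by
        have : 0 < min (r ^ 2) ε := by positivity
        linarith)
    have hv1 : w x i - r ^ 2 < v x i := by linarith [min_le_left (r ^ 2) ε]
    have hv2 : w x i - ε < v x i := by linarith [min_le_right (r ^ 2) ε]
    have hvi : Continuous fun h => v (translate x h) i :=
      (hLip v hv i).continuous.comp (continuous_translate x)
    have hΨc : ContinuousOn (fun h : Momentum N => v (translate x h) i - (φ h + ‖h‖ ^ 2))
        (Metric.closedBall 0 r) := by
      refine hvi.continuousOn.sub (ContinuousOn.add (fun h hh => ?_) (by fun_prop))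
      have : h ∈ Metric.ball (0 : Momentum N) r₀ := Metric.closedBall_subset_ball hrr hh
      exact (hball h this).1.1.continuousAt.continuousWithinAt
    obtain ⟨h, hh, hmaxh⟩ := (isCompact_closedBall (0 : Momentum N) r).exists_isMaxOn
      ⟨0, by simpa using hrpos.le⟩ hΨc
    have hh1 := hball h (Metric.closedBall_subset_ball hrr hh)
    have h0 := hmaxh (show (0 : Momentum N) ∈ Metric.closedBall 0 r by simpa using hrpos.le)
    simp only [translate_zero, mem_ofPred_eq, norm_zero] at h0
    have hvw' : v (translate x h) i ≤ w (translate x h) i := (hw _ i).1 ⟨v, hv, rfl⟩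
    have hh2 := hh1.2
    simp only [translate_zero] at hh2
    have hhr : ‖h‖ < r := lt_of_pow_lt_pow_left₀ 2 hrpos.le (by linarith)
    refine ⟨h, hhr.trans hrε, ?_⟩
    have hmem := mem_superdifferential_of_chart (u := fun y => v y i) (x := x)
      (hh1.1.add (IsC1WithGradient.norm_sq h)) (hmaxh.isLocalMax
        (mem_of_superset (Metric.isOpen_ball.mem_nhds (by simpa using hhr))
          Metric.ball_subset_closedBall))
    have h1 := (h𝓕 v hv).le _ i _ hmem
    have h2 := (hc (translate x h)).mulVec_add_le (v := v (translate x h)) (w := w (translate x h))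
      (fun j => (hw _ j).1 ⟨v, hv, rfl⟩) i
    have h3 := mul_le_mul_of_nonneg_left (show w x i - ε + (φ h - φ 0) - w (translate x h) i ≤
      v (translate x h) i - w (translate x h) i by nlinarith [sq_nonneg ‖h‖])
      ((hc (translate x h)).diag_nonneg i)
    linarith
  choose h hh hle using fun k : ℕ => key _ (Nat.one_div_pos_of_nat (α := ℝ) (n := k))
  have hto : Tendsto h atTop (𝓝 0) :=
    squeeze_zero_norm (fun k => (hh k).le) tendsto_one_div_add_atTop_nhds_zero_nat
  have hx := (tendsto_translate x).comp hto
  have hP : Tendsto (fun k => gradient φ (h k) + (2 : ℝ) • h k) atTop (𝓝 p) := by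
    have := ((IsC1WithGradient.tendsto_gradient ⟨hφ, hgrad⟩).comp hto).add
      (hto.const_smul (2 : ℝ))
    simpa using this
  have hφt : Tendsto (fun k => φ (h k)) atTop (𝓝 (φ 0)) := hφ.continuousAt.tendsto.comp hto
  have hwt : Tendsto (fun k => w (translate x (h k)) i) atTop (𝓝 (w x i)) :=
    ((hwLip i).continuous.tendsto x).comp hx
  have hlim := ((hH i).tendsto hx hP).add ((((continuous_mulVec hB hwc i).tendsto x).comp hx).add
    ((((hB i i).tendsto x).comp hx).mul
      ((((tendsto_const_nhds (x := w x i)).sub (tendsto_one_div_add_atTop_nhds_zero_nat (𝕜 := ℝ))).add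
        (hφt.sub_const (φ 0))).sub hwt)))
  have := le_of_tendsto hlim (Eventually.of_forall hle)
  simpa using this

end Suprema

/-! ### The Mañé matrix -/

section Mane

variable {N m : ℕ} {H : Fin m → Torus N → Momentum N → ℝ}
  {B : Torus N → Matrix (Fin m) (Fin m) ℝ}

/-- The uniform oscillation bound ensures that `sSup` is a genuine supremum and not its default
value. -/
lemma isLUB_mane (hH : ∀ i, IsConvexHamiltonian (H i))
    (hB : ∀ i j, Continuous fun x => B x i j) (hc : ∀ x, IsCoupling (B x))
    (hi : ∀ x, IsIrreducible (B x)) (hd : ∀ x, IsDegenerate (B x))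
    (hex : ∃ v, IsCriticalSubsolution H B v) (i j : Fin m) (y x : Torus N) :
    IsLUB {r : ℝ | ∃ v, IsCriticalSubsolution H B v ∧ r = v x i - v y j} (mane H B i j y x) := by
  obtain ⟨L, C, hL, hLC⟩ := exists_equi_bounds hH hB hc hi hd (criticalValue H B)
  obtain ⟨v₀, hv₀⟩ := hex
  refine isLUB_csSup ⟨_, v₀, hv₀, rfl⟩ ⟨C, ?_⟩
  rintro r ⟨v, hv, rfl⟩
  exact (hLC v hv).2 x y i j

/-- Degeneracy of `B` makes each `v - v_k(y)` a critical subsolution, and the column is the supremum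
of these. -/
lemma isCriticalSubsolution_mane (hH : ∀ i, IsConvexHamiltonian (H i))
    (hB : ∀ i j, Continuous fun x => B x i j) (hc : ∀ x, IsCoupling (B x))
    (hi : ∀ x, IsIrreducible (B x)) (hd : ∀ x, IsDegenerate (B x))
    (hex : ∃ v, IsCriticalSubsolution H B v) (k : Fin m) (y : Torus N) :
    IsCriticalSubsolution H B fun x i => mane H B i k y x := by
  obtain ⟨L, C, hL, hLC⟩ := exists_equi_bounds hH hB hc hi hd (criticalValue H B)
  have hshift : ∀ v ∈ {w : Torus N → Fin m → ℝ | ∃ v, IsCriticalSubsolution H B v ∧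
      w = fun x i => v x i + -v y k}, IsSubsolution H B (criticalValue H B) v := by
    rintro _ ⟨v, hv, rfl⟩
    exact IsSubsolution.add_const hd hv _
  refine isSubsolution_of_isLUB hH hB hc hshift (fun v hv => (hLC v (hshift v hv)).1) ?_
  intro x i
  convert isLUB_mane hH hB hc hi hd hex i k y x using 1
  ext r
  constructor
  · rintro ⟨_, ⟨v, hv, rfl⟩, rfl⟩
    exact ⟨v, hv, (sub_eq_add_neg _ _).symm⟩
  · rintro ⟨v, hv, rfl⟩
    exact ⟨_, ⟨v, hv, rfl⟩, sub_eq_add_neg _ _⟩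

end Mane

/-! ### Perron bumps -/

section Bump

variable {N m : ℕ} {H : Fin m → Torus N → Momentum N → ℝ}
  {B : Torus N → Matrix (Fin m) (Fin m) ℝ} {a : ℝ}

lemma mulVec_update (A : Matrix (Fin m) (Fin m) ℝ) (w : Fin m → ℝ) (i : Fin m) (c : ℝ)
    (j : Fin m) : (A *ᵥ Function.update w i c) j = (A *ᵥ w) j + A j i * (c - w i) := by
  have h1 : (A *ᵥ Function.update w i c) j - (A *ᵥ w) j =
      ∑ l, A j l * (Function.update w i c l - w l) := by
    simp only [Matrix.mulVec, dotProduct, ← Finset.sum_sub_distrib, mul_sub]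
  rw [Finset.sum_eq_single i (fun l _ hl => by simp [hl]) (by simp), Function.update_self] at h1
  linarith

open Classical in
/-- The maximum of `u` and of `θ`, read in the chart at `x₀`, on the image of the ball of
radius `r`; the function `u` elsewhere. -/
noncomputable def glueMax {N : ℕ} (u : Torus N → ℝ) (x₀ : Torus N) (r : ℝ) (θ : Momentum N → ℝ)
    (x : Torus N) : ℝ :=
  if hx : ∃ h, ‖h‖ < r ∧ translate x₀ h = x then max (u x) (θ hx.choose) else u x

section Glue

variable {u : Torus N → ℝ} {x₀ : Torus N} {r : ℝ} {θ : Momentum N → ℝ}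

lemma le_glueMax (x : Torus N) : u x ≤ glueMax u x₀ r θ x := by
  unfold glueMax
  split_ifs
  · exact le_max_left _ _
  · exact le_rfl

/-- For `r ≤ 1 / 2` the chart is injective on the ball, so the chosen preimage is `h` itself. -/
lemma glueMax_translate (hr : r ≤ 1 / 2) {h : Momentum N} (hh : ‖h‖ < r) :
    glueMax u x₀ r θ (translate x₀ h) = max (u (translate x₀ h)) (θ h) := by
  have hx : ∃ h', ‖h'‖ < r ∧ translate x₀ h' = translate x₀ h := ⟨h, hh, rfl⟩
  have h1 : hx.choose = h := translate_injective_of_norm_sub_lt x₀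
    (by linarith [norm_sub_le hx.choose h, hx.choose_spec.1]) hx.choose_spec.2
  unfold glueMax
  rw [dif_pos hx, h1]

lemma glueMax_eq_of_notMem {x : Torus N} (hx : ¬∃ h, ‖h‖ < r ∧ translate x₀ h = x) :
    glueMax u x₀ r θ x = u x := dif_neg hx

lemma glueMax_eventuallyEq (hr : r ≤ 1 / 2) {ρ : ℝ} (hρ : ρ < r)
    (hθ : ∀ h, ρ < ‖h‖ → ‖h‖ < r → θ h ≤ u (translate x₀ h)) {x : Torus N}
    (hx : ¬∃ h, ‖h‖ < r ∧ translate x₀ h = x) : glueMax u x₀ r θ =ᶠ[𝓝 x] u := by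
  have hcl : IsClosed (translate x₀ '' Metric.closedBall 0 ρ) :=
    ((isCompact_closedBall _ _).image (continuous_translate x₀)).isClosed
  filter_upwards [hcl.isOpen_compl.mem_nhds (show x ∉ _ by
    rintro ⟨h, hh, rfl⟩
    exact hx ⟨h, (mem_closedBall_zero_iff.1 hh).trans_lt hρ, rfl⟩)] with y hy
  by_cases hyr : ∃ h, ‖h‖ < r ∧ translate x₀ h = y
  · obtain ⟨h, hh, rfl⟩ := hyr
    rw [glueMax_translate hr hh, max_eq_left]
    refine hθ h (not_le.1 fun hle => hy ⟨h, mem_closedBall_zero_iff.2 hle, rfl⟩) hh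
  · exact glueMax_eq_of_notMem hyr

lemma continuous_glueMax (hu : Continuous u) (hr : r ≤ 1 / 2) {ρ : ℝ} (hρ : ρ < r)
    (hθ : ∀ h, ρ < ‖h‖ → ‖h‖ < r → θ h ≤ u (translate x₀ h))
    (hθc : ∀ h, ‖h‖ < r → ContinuousAt θ h) : Continuous (glueMax u x₀ r θ) := by
  rw [continuous_iff_continuousAt]
  intro x
  by_cases hx : ∃ h, ‖h‖ < r ∧ translate x₀ h = x
  · obtain ⟨h, hh, rfl⟩ := hx
    rw [ContinuousAt, ← map_translate_nhds, tendsto_map'_iff, glueMax_translate hr hh]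
    have h1 : ContinuousAt (fun h => max (u (translate x₀ h)) (θ h)) h :=
      (hu.comp (continuous_translate x₀)).continuousAt.max (hθc h hh)
    refine h1.tendsto.congr' ?_
    filter_upwards [Metric.isOpen_ball.mem_nhds (mem_ball_zero_iff.2 hh)] with h' hh'
    exact (glueMax_translate hr (mem_ball_zero_iff.1 hh')).symm
  · exact hu.continuousAt.congr (glueMax_eventuallyEq hr hρ hθ hx).symm

/-- A supergradient of the glued function is a supergradient of `u`, or the gradient of `θ` at a
point where `θ` is the larger of the two functions. -/
lemma mem_superdifferential_glueMax (hr : r ≤ 1 / 2) {x : Torus N} {p : Momentum N}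
    {θ' : Momentum N → Momentum N} (hθc : ∀ h, ‖h‖ < r → IsC1WithGradient θ (θ' h) h)
    (hp : p ∈ superdifferential (glueMax u x₀ r θ) x) :
    (glueMax u x₀ r θ x = u x ∧ p ∈ superdifferential u x ∧
      ∀ h, ‖h‖ < r → translate x₀ h = x → θ h ≤ u x) ∨
    ∃ h, ‖h‖ < r ∧ translate x₀ h = x ∧ glueMax u x₀ r θ x = θ h ∧ p = θ' h := by
  by_cases hx : glueMax u x₀ r θ x = u x
  · refine Or.inl ⟨hx, superdifferential_subset_of_le
      (Eventually.of_forall le_glueMax) hx.symm hp, ?_⟩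
    rintro h hh rfl
    rw [glueMax_translate hr hh] at hx
    exact max_eq_left_iff.1 hx
  · right
    have hex : ∃ h, ‖h‖ < r ∧ translate x₀ h = x := by
      by_contra h
      exact hx (glueMax_eq_of_notMem h)
    obtain ⟨h, hh, rfl⟩ := hex
    have heq : glueMax u x₀ r θ (translate x₀ h) = θ h := by
      rw [glueMax_translate hr hh] at hx ⊢
      exact max_eq_right (le_of_not_ge fun hle => hx (max_eq_left hle))
    refine ⟨h, hh, rfl, heq, eq_of_mem_superdifferential_of_le (hθc h hh) ?_ heq.symm hp⟩
    filter_upwards [Metric.isOpen_ball.mem_nhds (mem_ball_zero_iff.2 hh)] with h' hh'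
    rw [glueMax_translate hr (mem_ball_zero_iff.1 hh')]
    exact le_max_right _ _

end Glue

/-- A subsolution that fails to be a supersolution of the `i`-th equation at `x₀` can be raised
near `x₀` in its `i`-th component, and made strict there. -/
lemma IsSubsolution.exists_bump (hH : ∀ i, IsConvexHamiltonian (H i))
    (hB : ∀ i j, Continuous fun x => B x i j) (hc : ∀ x, IsCoupling (B x))
    {ψ : Torus N → Fin m → ℝ} (hψ : IsSubsolution H B a ψ) {x₀ : Torus N} {i : Fin m}
    {p : Momentum N} (hp : p ∈ subdifferential (fun y => ψ y i) x₀)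
    (hlt : H i x₀ p + (B x₀ *ᵥ ψ x₀) i < a) {V : Set (Torus N)} (hV : V ∈ 𝓝 x₀) :
    ∃ ψ', IsSubsolution H B a ψ' ∧ (∀ x j, x ∉ V ∨ j ≠ i → ψ' x j = ψ x j) ∧
      ψ x₀ i < ψ' x₀ i ∧ ∃ δ > 0, ∀ᶠ x in 𝓝 x₀,
        ∀ q ∈ superdifferential (fun y => ψ' y i) x, H i x q + (B x *ᵥ ψ' x) i ≤ a - δ := by
  obtain ⟨φ, hφ, hmin, hgrad⟩ := hp
  -- Shifted to touch `ψ_i` at `x₀` and bent to lie strictly below it elsewhere nearby, so that a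
  -- small lift crosses `ψ_i` only close to `x₀`.
  set θ₀ : Momentum N → ℝ := fun h => φ h + (-1) * ‖h‖ ^ 2 + (ψ x₀ i - φ 0) with hθ₀
  set P : Momentum N → Momentum N := fun h => gradient φ h + (-1 : ℝ) • (2 : ℝ) • h with hP
  obtain ⟨δ, hδ, hδlt⟩ : ∃ δ > 0, H i x₀ p + (B x₀ *ᵥ ψ x₀) i < a - 2 * δ :=
    ⟨(a - (H i x₀ p + (B x₀ *ᵥ ψ x₀) i)) / 4, by linarith, by linarith⟩
  have hPt : Tendsto P (𝓝 0) (𝓝 p) := by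
    have := (IsC1WithGradient.tendsto_gradient ⟨hφ, hgrad⟩).add
      (((tendsto_id (x := 𝓝 (0 : Momentum N))).const_smul (2 : ℝ)).const_smul (-1 : ℝ))
    simpa [hP] using this
  have hstrict : ∀ᶠ h in 𝓝 (0 : Momentum N), H i (translate x₀ h) (P h) +
      (B (translate x₀ h) *ᵥ ψ (translate x₀ h)) i < a - 2 * δ :=
    (((hH i).tendsto (tendsto_translate x₀) hPt).add
      (((continuous_mulVec hB hψ.continuous i).tendsto x₀).comp
        (tendsto_translate x₀))).eventually_lt_const hδlt
  obtain ⟨r₀, hr₀, hball⟩ := Metric.eventually_nhds_iff_ball.1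
    ((IsC1WithGradient.eventually hφ).and (hmin.and (hstrict.and
      ((tendsto_translate x₀).eventually hV))))
  set r : ℝ := min r₀ (1 / 2) with hr
  have hrpos : 0 < r := by positivity
  have hr2 : r ≤ 1 / 2 := min_le_right _ _
  have hball' : ∀ h : Momentum N, ‖h‖ < r → h ∈ Metric.ball (0 : Momentum N) r₀ := fun h hh =>
    mem_ball_zero_iff.2 (hh.trans_le (min_le_left _ _))
  obtain ⟨R, hR0, hR⟩ := exists_forall_abs_le (hB i i)
  -- The first bound lets the lift use at most `δ` of the margin `2δ` through the diagonal coupling;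
  -- the second keeps the lifted function below `ψ_i` outside radius `r / 2`.
  set η : ℝ := min (δ / (R + 1)) ((r / 2) ^ 2) with hη
  have hηpos : 0 < η := by positivity
  have hηδ : ∀ x, B x i i * η ≤ δ := fun x => by
    calc B x i i * η ≤ (R + 1) * (δ / (R + 1)) := by
          refine mul_le_mul ?_ (min_le_left _ _) hηpos.le (by positivity)
          linarith [(abs_le.1 (hR x)).2]
      _ = δ := by field_simp
  set θ : Momentum N → ℝ := fun h => θ₀ h + η with hθ
  have hθC : ∀ h, ‖h‖ < r → IsC1WithGradient θ (P h) h := fun h hh => by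
    have := (((hball h (hball' h hh)).1.add ((IsC1WithGradient.norm_sq h).const_mul (-1))).add
      (IsC1WithGradient.const (ψ x₀ i - φ 0))).add (IsC1WithGradient.const η)
    simpa [hθ, hθ₀, hP] using this
  have hθle : ∀ h, ‖h‖ < r → θ₀ h + ‖h‖ ^ 2 ≤ ψ (translate x₀ h) i := fun h hh => by
    have := (hball h (hball' h hh)).2.1
    simp only [translate_zero] at this
    simp only [hθ₀]
    linarith
  have hθout : ∀ h, r / 2 < ‖h‖ → ‖h‖ < r → θ h ≤ ψ (translate x₀ h) i := fun h hh hh' => by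
    have h1 := hθle h hh'
    have h2 : (r / 2) ^ 2 ≤ ‖h‖ ^ 2 := pow_le_pow_left₀ (by positivity) hh.le 2
    have h3 : η ≤ (r / 2) ^ 2 := min_le_right _ _
    simp only [hθ]
    linarith
  set g := glueMax (fun y => ψ y i) x₀ r θ with hg
  have hψi : Continuous fun y => ψ y i := (continuous_apply i).comp hψ.continuous
  have hgc : Continuous g := continuous_glueMax hψi hr2 (half_lt_self hrpos) hθout
    fun h hh => (hθC h hh).1.continuousAt
  have hθ0 : θ 0 = ψ x₀ i + η := by simp [hθ, hθ₀]
  have hkey : ∀ h, ‖h‖ < r → g (translate x₀ h) = θ h →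
      H i (translate x₀ h) (P h) + (B (translate x₀ h) *ᵥ
        Function.update (ψ (translate x₀ h)) i (g (translate x₀ h))) i ≤ a - δ := by
    intro h hh he
    have h1 := (hball h (hball' h hh)).2.2.1
    have h2 := mul_le_mul_of_nonneg_left
      (show g (translate x₀ h) - ψ (translate x₀ h) i ≤ η by
        rw [he]; simp only [hθ]; nlinarith [hθle h hh, sq_nonneg ‖h‖])
      ((hc (translate x₀ h)).diag_nonneg i)
    rw [mulVec_update]
    linarith [hηδ (translate x₀ h)]
  refine ⟨fun x => Function.update (ψ x) i (g x), ⟨hψ.continuous.update i hgc, ?_⟩, ?_, ?_,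
    δ, hδ, ?_⟩
  · intro x j q hq
    by_cases hj : j = i
    · subst hj
      simp only [Function.update_self] at hq
      rcases mem_superdifferential_glueMax hr2 hθC hq with ⟨h1, h2, -⟩ | ⟨h, hh, rfl, h1, rfl⟩
      · have : Function.update (ψ x) j (g x) = ψ x := by
          rw [hg, h1, Function.update_eq_self]
        rw [this]
        exact hψ.le x j q h2
      · exact (hkey h hh h1).trans (by linarith)
    -- Raising component `i` only helps the other equations, by the sign of the off-diagonal
    -- entries.
    · simp only [Function.update_of_ne hj] at hq
      rw [mulVec_update]
      have h1 := hψ.le x j q hq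
      have h2 := mul_nonpos_of_nonpos_of_nonneg ((hc x).offDiag_nonpos j i (Ne.symm hj))
        (sub_nonneg.2 (le_glueMax (u := fun y => ψ y i) (x₀ := x₀) (r := r) (θ := θ) x))
      linarith
  · rintro x j (hx | hj)
    · have : g x = ψ x i := by
        refine glueMax_eq_of_notMem ?_
        rintro ⟨h, hh, rfl⟩
        exact hx (hball h (hball' h hh)).2.2.2
      simp only [this, Function.update_eq_self]
    · exact Function.update_of_ne hj _ _
  · have h1 : g x₀ = max (ψ x₀ i) (θ 0) := by
      have := glueMax_translate (u := fun y => ψ y i) (x₀ := x₀) (θ := θ) hr2 (h := 0)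
        (by simpa using hrpos)
      rwa [translate_zero] at this
    simp only [Function.update_self]
    rw [h1, hθ0]
    exact lt_max_of_lt_right (by linarith)
  · rw [← map_translate_nhds_zero x₀, eventually_map]
    have h1 : Tendsto (fun h => θ h - ψ (translate x₀ h) i) (𝓝 0) (𝓝 η) := by
      have := ((hθC 0 (by simpa using hrpos)).1.continuousAt.tendsto).sub
        ((hψi.tendsto x₀).comp (tendsto_translate x₀))
      rw [hθ0] at this
      simpa using this
    -- Near `x₀` the lifted function exceeds `ψ_i`, so every supergradient comes from it and carries
    -- the margin `δ`.
    filter_upwards [h1.eventually_const_lt hηpos, Metric.ball_mem_nhds 0 hrpos] with h hlt' hh q hq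
    have hh' := mem_ball_zero_iff.1 hh
    simp only [Function.update_self] at hq
    rcases mem_superdifferential_glueMax hr2 hθC hq with ⟨-, -, h2⟩ | ⟨h', hh'', he, h2, rfl⟩
    · have := h2 h hh' rfl
      linarith
    · rw [← he] at h2 ⊢
      exact hkey h' hh'' h2

end Bump

/-! ### Strict subsolutions and comparison at maximum points -/

section Comparison

variable {N m : ℕ} {H : Fin m → Torus N → Momentum N → ℝ}
  {B : Torus N → Matrix (Fin m) (Fin m) ℝ} {a : ℝ}

/-- `w` is a subsolution of the `k`-th equation near `x` with right-hand side `a - δ`. -/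
def IsStrictNear (H : Fin m → Torus N → Momentum N → ℝ) (B : Torus N → Matrix (Fin m) (Fin m) ℝ)
    (a : ℝ) (k : Fin m) (δ : ℝ) (w : Torus N → Fin m → ℝ) (x : Torus N) : Prop :=
  ∀ᶠ y in 𝓝 x, ∀ p ∈ superdifferential (fun z => w z k) y,
    H k y p + (B y *ᵥ w y) k ≤ a - δ

lemma IsSubsolution.isStrictNear_zero {w : Torus N → Fin m → ℝ} (hw : IsSubsolution H B a w)
    (k : Fin m) (x : Torus N) : IsStrictNear H B a k 0 w x :=
  Eventually.of_forall fun y p hp => by simpa using hw.le y k p hp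

/-- The convex combination of two systems of functions. -/
def convexComb (s t : ℝ) (v w : Torus N → Fin m → ℝ) : Torus N → Fin m → ℝ :=
  fun x i => s * v x i + t * w x i

lemma mulVec_convexComb (A : Matrix (Fin m) (Fin m) ℝ) (s t : ℝ) (v w : Torus N → Fin m → ℝ)
    (x : Torus N) (i : Fin m) :
    (A *ᵥ convexComb s t v w x) i = s * (A *ᵥ v x) i + t * (A *ᵥ w x) i := by
  have : convexComb s t v w x = s • v x + t • w x := rfl
  rw [this, Matrix.mulVec_add, Matrix.mulVec_smul, Matrix.mulVec_smul]
  rfl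

lemma exists_chartLipschitz (hH : ∀ i, IsConvexHamiltonian (H i))
    (hB : ∀ i j, Continuous fun x => B x i j) (hc : ∀ x, IsCoupling (B x))
    (hi : ∀ x, IsIrreducible (B x)) (hd : ∀ x, IsDegenerate (B x)) (a : ℝ) :
    ∃ L : ℝ, 0 ≤ L ∧ ∀ u, IsSubsolution H B a u → ∀ i, ChartLipschitz L fun x => u x i := by
  obtain ⟨L, _, hL, h⟩ := exists_equi_bounds hH hB hc hi hd a
  exact ⟨L, hL, fun u hu => (h u hu).1⟩

/-- With the linear coupling moved to the right-hand side, this is the scalar convexity result.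
Taking one margin equal to zero shows that a single strict summand makes the combination strict. -/
lemma IsStrictNear.convexComb (hH : ∀ i, IsConvexHamiltonian (H i))
    (hB : ∀ i j, Continuous fun x => B x i j) (hc : ∀ x, IsCoupling (B x))
    (hi : ∀ x, IsIrreducible (B x)) (hd : ∀ x, IsDegenerate (B x))
    {v w : Torus N → Fin m → ℝ} (hv : IsSubsolution H B a v) (hw : IsSubsolution H B a w)
    {s t : ℝ} (hs : 0 < s) (ht : 0 < t) (hst : s + t = 1) {k : Fin m} {δ δ' : ℝ} {x : Torus N}
    (hvx : IsStrictNear H B a k δ v x) (hwx : IsStrictNear H B a k δ' w x) :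
    IsStrictNear H B a k (s * δ + t * δ') (convexComb s t v w) x := by
  obtain ⟨L, hL0, hL⟩ := exists_chartLipschitz hH hB hc hi hd a
  filter_upwards [hvx.eventually_nhds, hwx.eventually_nhds] with y hvy hwy p hp
  have h := (hH k).le_of_mem_superdifferential_convexComb (x₀ := y) hL0 (hL v hv k) (hL w hw k)
    (F := fun y => a - δ - (B y *ᵥ v y) k) (G := fun y => a - δ' - (B y *ᵥ w y) k)
    (continuous_const.sub (continuous_mulVec hB hv.continuous k))
    (continuous_const.sub (continuous_mulVec hB hw.continuous k)) hs ht hst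
    (hvy.mono fun z hz q hq => by linarith [hz q hq])
    (hwy.mono fun z hz q hq => by linarith [hz q hq]) hp
  rw [mulVec_convexComb]
  have : a = s * a + t * a := by rw [← add_mul, hst, one_mul]
  linarith

lemma IsSubsolution.convexComb (hH : ∀ i, IsConvexHamiltonian (H i))
    (hB : ∀ i j, Continuous fun x => B x i j) (hc : ∀ x, IsCoupling (B x))
    (hi : ∀ x, IsIrreducible (B x)) (hd : ∀ x, IsDegenerate (B x))
    {v w : Torus N → Fin m → ℝ} (hv : IsSubsolution H B a v) (hw : IsSubsolution H B a w)
    {s t : ℝ} (hs : 0 < s) (ht : 0 < t) (hst : s + t = 1) :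
    IsSubsolution H B a (convexComb s t v w) := by
  refine ⟨continuous_pi fun i =>
    (((continuous_apply i).comp hv.continuous).const_mul s).add
      (((continuous_apply i).comp hw.continuous).const_mul t), fun x i p hp => ?_⟩
  simpa using (IsStrictNear.convexComb hH hB hc hi hd hv hw hs ht hst
    (hv.isStrictNear_zero i x) (hw.isStrictNear_zero i x)).self_of_nhds p hp

/-- At a global maximum of the difference of a subsolution and a supersolution, a component
realizing the maximum cannot be a strict one. -/
lemma IsStrictNear.mulVec_sub_le (hH : ∀ i, IsConvexHamiltonian (H i))
    (hB : ∀ i j, Continuous fun x => B x i j) (hc : ∀ x, IsCoupling (B x))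
    (hi : ∀ x, IsIrreducible (B x)) (hd : ∀ x, IsDegenerate (B x))
    {v u : Torus N → Fin m → ℝ} (hv : IsSubsolution H B a v) (hu : IsSupersolution H B a u)
    {k : Fin m} {δ : ℝ} {x : Torus N} (hvx : IsStrictNear H B a k δ v x)
    (hmax : ∀ y, v y k - u y k ≤ v x k - u x k) : (B x *ᵥ (v x - u x)) k ≤ -δ := by
  obtain ⟨L, hL0, hL⟩ := exists_chartLipschitz hH hB hc hi hd a
  have h := (hH k).le_of_isLocalMax_sub (x₀ := x) hL0 (hL v hv k)
    ((continuous_apply k).comp hu.continuous : Continuous fun y => u y k)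
    (F := fun y => a - δ - (B y *ᵥ v y) k) (G := fun y => a - (B y *ᵥ u y) k)
    (continuous_const.sub (continuous_mulVec hB hv.continuous k))
    (continuous_const.sub (continuous_mulVec hB hu.continuous k))
    (hvx.mono fun z hz q hq => by linarith [hz q hq])
    (Eventually.of_forall fun z q hq => by linarith [hu.ge z k q hq])
    (Eventually.of_forall hmax)
  rw [Matrix.mulVec_sub, Pi.sub_apply]
  linarith

/-- At a maximum point of the difference of a subsolution and a supersolution, all the components
of the difference coincide. -/
lemma sub_eq_of_isMax (hH : ∀ i, IsConvexHamiltonian (H i))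
    (hB : ∀ i j, Continuous fun x => B x i j) (hc : ∀ x, IsCoupling (B x))
    (hi : ∀ x, IsIrreducible (B x)) (hd : ∀ x, IsDegenerate (B x))
    {v u : Torus N → Fin m → ℝ} (hv : IsSubsolution H B a v) (hu : IsSupersolution H B a u)
    {M : ℝ} (hM : ∀ y i, v y i - u y i ≤ M) {x : Torus N} (hx : ∃ i, v x i - u x i = M)
    (i : Fin m) : v x i - u x i = M := by
  refine (hi x).eq_of_mulVec_nonpos (hc x) (hd x) (w := v x - u x) (hM x) hx (fun j hj => ?_) i
  have := (hv.isStrictNear_zero j x).mulVec_sub_le hH hB hc hi hd hv hu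
    (fun y => (hM y j).trans_eq hj.symm)
  simpa using this

lemma not_isStrictNear_of_isMax (hH : ∀ i, IsConvexHamiltonian (H i))
    (hB : ∀ i j, Continuous fun x => B x i j) (hc : ∀ x, IsCoupling (B x))
    (hi : ∀ x, IsIrreducible (B x)) (hd : ∀ x, IsDegenerate (B x))
    {v u : Torus N → Fin m → ℝ} (hv : IsSubsolution H B a v) (hu : IsSupersolution H B a u)
    {M : ℝ} (hM : ∀ y i, v y i - u y i ≤ M) {x : Torus N} (hx : ∃ i, v x i - u x i = M)
    (k : Fin m) {δ : ℝ} (hδ : 0 < δ) : ¬IsStrictNear H B a k δ v x := by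
  intro hs
  have hall := sub_eq_of_isMax hH hB hc hi hd hv hu hM hx
  have h1 := hs.mulVec_sub_le hH hB hc hi hd hv hu (fun y => (hM y k).trans_eq (hall k).symm)
  have h2 := (hc x).mulVec_nonneg (hd x) (w := v x - u x) (i := k)
    (fun j => ((hall j).trans (hall k).symm).le)
  linarith

end Comparison

/-! ### The Aubry set and the maximum of the difference -/

section Aubry

variable {N m : ℕ} {H : Fin m → Torus N → Momentum N → ℝ}
  {B : Torus N → Matrix (Fin m) (Fin m) ℝ}

/-- Off the Aubry set there is a critical subsolution whose `k`-th equation is locally strict. -/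
lemma exists_isStrictNear_of_notMem_aubrySet (hH : ∀ i, IsConvexHamiltonian (H i))
    (hB : ∀ i j, Continuous fun x => B x i j) (hc : ∀ x, IsCoupling (B x))
    (hi : ∀ x, IsIrreducible (B x)) (hd : ∀ x, IsDegenerate (B x))
    (hex : ∃ v, IsCriticalSubsolution H B v) {k : Fin m} {y : Torus N}
    (hy : y ∉ aubrySet H B k) :
    ∃ w, IsCriticalSubsolution H B w ∧ ∃ δ > 0,
      IsStrictNear H B (criticalValue H B) k δ w y := by
  have hsub := isCriticalSubsolution_mane hH hB hc hi hd hex k y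
  set ψ : Torus N → Fin m → ℝ := fun x i => mane H B i k y x with hψ
  have hlub := fun i x => isLUB_mane hH hB hc hi hd hex i k y x
  have hψ0 : ψ y k = 0 := by
    refine (hlub k y).unique ?_
    obtain ⟨v, hv⟩ := hex
    convert isLUB_singleton (a := (0 : ℝ)) using 1
    ext r
    simp only [sub_self, mem_ofPred_eq, mem_singleton_iff]
    exact ⟨fun ⟨_, _, h⟩ => h, fun h => ⟨v, hv, h⟩⟩
  obtain ⟨x₀, i, p, hp, hlt⟩ : ∃ x₀ i, ∃ p ∈ subdifferential (fun z => ψ z i) x₀,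
      H i x₀ p + (B x₀ *ᵥ ψ x₀) i < criticalValue H B := by
    by_contra hcon
    push Not at hcon
    exact hy ⟨hsub, hsub.continuous, fun x i p hp => hcon x i p hp⟩
  -- A bump that leaves component `k` at `y` unchanged would violate this maximality, which forces
  -- `i = k` and then `x₀ = y`.
  have hmaximal : ∀ w, IsCriticalSubsolution H B w → w y k = 0 → w x₀ i ≤ ψ x₀ i :=
    fun w hw hw0 => (hlub i x₀).1 ⟨w, hw, by rw [hw0, sub_zero]⟩
  have hik : i = k := by
    by_contra hne
    obtain ⟨w, hw, hoff, hgt, -⟩ := hsub.exists_bump hH hB hc hp hlt univ_mem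
    exact hgt.not_ge (hmaximal w hw ((hoff y k (Or.inr (Ne.symm hne))).trans hψ0))
  subst hik
  have hxy : x₀ = y := by
    by_contra hne
    obtain ⟨w, hw, hoff, hgt, -⟩ := hsub.exists_bump hH hB hc hp hlt
      (isOpen_compl_singleton.mem_nhds (show x₀ ∈ ({y}ᶜ : Set (Torus N)) from hne))
    exact hgt.not_ge (hmaximal w hw ((hoff y i (Or.inl (by simp))).trans hψ0))
  subst hxy
  obtain ⟨w, hw, -, -, δ, hδ, hs⟩ := hsub.exists_bump hH hB hc hp hlt univ_mem
  exact ⟨w, hw, δ, hδ, hs⟩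

/-- On a compact set disjoint from the Aubry set, some critical subsolution has a uniformly strict
`k`-th equation. -/
lemma exists_isStrictNear_of_isCompact (hH : ∀ i, IsConvexHamiltonian (H i))
    (hB : ∀ i j, Continuous fun x => B x i j) (hc : ∀ x, IsCoupling (B x))
    (hi : ∀ x, IsIrreducible (B x)) (hd : ∀ x, IsDegenerate (B x))
    (hex : ∃ v, IsCriticalSubsolution H B v) {k : Fin m} {K : Set (Torus N)} (hK : IsCompact K)
    (hKA : ∀ y ∈ K, y ∉ aubrySet H B k) :
    ∃ w, IsCriticalSubsolution H B w ∧ ∃ δ > 0, ∃ U, IsOpen U ∧ K ⊆ U ∧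
      ∀ x ∈ U, IsStrictNear H B (criticalValue H B) k δ w x := by
  refine hK.induction_on (p := fun S => ∃ w, IsCriticalSubsolution H B w ∧ ∃ δ > 0, ∃ U,
    IsOpen U ∧ S ⊆ U ∧ ∀ x ∈ U, IsStrictNear H B (criticalValue H B) k δ w x) ?_ ?_ ?_ ?_
  · obtain ⟨v, hv⟩ := hex
    exact ⟨v, hv, 1, one_pos, ∅, isOpen_empty, Subset.rfl, by simp⟩
  · rintro S T hST ⟨w, hw, δ, hδ, U, hU, hTU, h⟩
    exact ⟨w, hw, δ, hδ, U, hU, hST.trans hTU, h⟩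
  · rintro S T ⟨w, hw, δ, hδ, U, hU, hSU, h⟩ ⟨w', hw', δ', hδ', U', hU', hTU', h'⟩
    have hh : (0 : ℝ) < 1 / 2 := by norm_num
    have hadd : (1 / 2 : ℝ) + 1 / 2 = 1 := by norm_num
    refine ⟨convexComb (1 / 2) (1 / 2) w w',
      IsSubsolution.convexComb hH hB hc hi hd hw hw' hh hh hadd,
      1 / 2 * min δ δ', by positivity, U ∪ U', hU.union hU', union_subset_union hSU hTU', ?_⟩
    rintro x (hx | hx)
    · refine (IsStrictNear.convexComb hH hB hc hi hd hw hw' hh hh hadd (h x hx)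
        (hw'.isStrictNear_zero k x)).mono fun z hz q hq => (hz q hq).trans ?_
      linarith [min_le_left δ δ']
    · refine (IsStrictNear.convexComb hH hB hc hi hd hw hw' hh hh hadd
        (hw.isStrictNear_zero k x) (h' x hx)).mono fun z hz q hq => (hz q hq).trans ?_
      linarith [min_le_right δ δ']
  · intro y hy
    obtain ⟨w, hw, δ, hδ, hs⟩ :=
      exists_isStrictNear_of_notMem_aubrySet hH hB hc hi hd hex (hKA y hy)
    obtain ⟨U, hUs, hU, hyU⟩ := eventually_nhds_iff.1 hs.eventually_nhds
    exact ⟨U, mem_nhdsWithin_of_mem_nhds (hU.mem_nhds hyU), w, hw, δ, hδ, U, hU, Subset.rfl, hUs⟩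

lemma exists_forall_apply_le {f : Torus N → Fin m → ℝ} (hf : Continuous f) [Nonempty (Fin m)] :
    ∃ x i, ∀ y j, f y j ≤ f x i := by
  have h : ∀ i, ∃ x, ∀ y, f y i ≤ f x i := fun i => by
    obtain ⟨x, -, hx⟩ := isCompact_univ.exists_isMaxOn ⟨(0 : Torus N), mem_univ _⟩
      ((continuous_apply i).comp hf).continuousOn
    exact ⟨x, fun y => hx (mem_univ y)⟩
  choose x hx using h
  obtain ⟨i, hi⟩ := Finite.exists_max fun i => f (x i) i
  exact ⟨x i, i, fun y j => (hx j y).trans (hi j)⟩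

/-- The maximum of the difference of a critical subsolution and a critical supersolution is
attained on the Aubry set. -/
lemma exists_mem_aubrySet_isMax (hH : ∀ i, IsConvexHamiltonian (H i))
    (hB : ∀ i j, Continuous fun x => B x i j) (hc : ∀ x, IsCoupling (B x))
    (hi : ∀ x, IsIrreducible (B x)) (hd : ∀ x, IsDegenerate (B x)) (k : Fin m)
    {v u : Torus N → Fin m → ℝ} (hv : IsCriticalSubsolution H B v)
    (hu : IsCriticalSupersolution H B u) :
    ∃ x ∈ aubrySet H B k, ∀ i y j, v y j - u y j ≤ v x i - u x i := by
  have : Nonempty (Fin m) := ⟨k⟩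
  obtain ⟨x₁, i₁, hmax⟩ := exists_forall_apply_le (hv.continuous.sub hu.continuous)
  set M : ℝ := v x₁ i₁ - u x₁ i₁ with hM
  have hcont : ∀ i, Continuous fun x => v x i - u x i := fun i =>
    ((continuous_apply i).comp hv.continuous).sub ((continuous_apply i).comp hu.continuous)
  set K : Set (Torus N) := ⋃ i, {x | v x i - u x i = M} with hKdef
  have hK : IsCompact K :=
    (isClosed_iUnion_of_finite fun i => isClosed_eq (hcont i) continuous_const).isCompact
  suffices h : ∃ x ∈ K, x ∈ aubrySet H B k by
    obtain ⟨x, hxK, hxA⟩ := h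
    refine ⟨x, hxA, fun i y j => ?_⟩
    have hx : ∃ i, v x i - u x i = M := by
      simpa [hKdef] using hxK
    exact (hmax y j).trans_eq (sub_eq_of_isMax hH hB hc hi hd hv hu hmax hx i).symm
  by_contra hcon
  push Not at hcon
  obtain ⟨w, hw, δ, hδ, U, hU, hKU, hs⟩ :=
    exists_isStrictNear_of_isCompact hH hB hc hi hd ⟨v, hv⟩ hK hcon
  -- The complement of `U` is compact and misses the contact set, so the difference stays below `M`
  -- by a fixed gap.
  obtain ⟨ε, hε, hεU⟩ : ∃ ε > 0, ∀ x ∉ U, ∀ i, v x i - u x i ≤ M - ε := by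
    have h : ∀ i, ∃ ε > 0, ∀ x ∉ U, v x i - u x i ≤ M - ε := fun i => by
      obtain ⟨M', hM', h⟩ := hU.isClosed_compl.isCompact.exists_forall_le' (a := -M)
        (hcont i).neg.continuousOn (fun x hx => neg_lt_neg (lt_of_le_of_ne (hmax x i)
          fun he => hx (hKU (mem_iUnion.2 ⟨i, he⟩))))
      exact ⟨M + M', by linarith, fun x hx => by
        have h1 : M' ≤ -(v x i - u x i) := h x hx
        linarith⟩
    choose ε hε h using h
    obtain ⟨i₂, hi₂⟩ := Finite.exists_min ε
    exact ⟨ε i₂, hε i₂, fun x hx i => by linarith [h i x hx, hi₂ i]⟩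
  obtain ⟨R, hR0, hR⟩ : ∃ R : ℝ, 0 ≤ R ∧ ∀ x i, |w x i - v x i| ≤ R := by
    choose R hR0 hR using fun i => exists_forall_abs_le
      (((continuous_apply i).comp hw.continuous).sub ((continuous_apply i).comp hv.continuous))
    obtain ⟨i₂, hi₂⟩ := Finite.exists_max R
    exact ⟨R i₂, hR0 i₂, fun x i => (hR i x).trans (hi₂ i)⟩
  -- Replacing `v` by the combination changes values by at most `t R`, both at the old and at the
  -- new maximum point; a total below `ε` keeps the new one in `U`.
  obtain ⟨t, ht0, ht1, htR⟩ : ∃ t : ℝ, 0 < t ∧ t < 1 ∧ t * (2 * R) < ε := by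
    refine ⟨min (1 / 2) (ε / (2 * R + 1) / 2), by positivity, ?_, ?_⟩
    · exact (min_le_left _ _).trans_lt (by norm_num)
    · calc min (1 / 2) (ε / (2 * R + 1) / 2) * (2 * R)
          ≤ ε / (2 * R + 1) / 2 * (2 * R + 1) := by
            gcongr
            · exact min_le_right _ _
            · linarith
        _ = ε / 2 := by field_simp
        _ < ε := by linarith
  have hs0 : 0 < 1 - t := by linarith
  have hst : 1 - t + t = 1 := by ring
  have hz : IsSubsolution H B (criticalValue H B) (convexComb (1 - t) t v w) :=
    IsSubsolution.convexComb hH hB hc hi hd hv hw hs0 ht0 hst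
  obtain ⟨x₂, i₂, hmax₂⟩ := exists_forall_apply_le (hz.continuous.sub hu.continuous)
  have hzv : ∀ x i, |convexComb (1 - t) t v w x i - v x i| ≤ t * R := fun x i => by
    have : convexComb (1 - t) t v w x i - v x i = t * (w x i - v x i) := by
      simp only [WCS.convexComb]; ring
    rw [this, abs_mul, abs_of_pos ht0]
    exact mul_le_mul_of_nonneg_left (hR x i) ht0.le
  have hx₂ : x₂ ∈ U := by
    by_contra hx
    have h1 := hεU x₂ hx i₂
    have h2 := abs_le.1 (hzv x₂ i₂)
    have h3 := abs_le.1 (hzv x₁ i₁)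
    have h4 := hmax₂ x₁ i₁
    simp only [Pi.sub_apply] at h4
    linarith [h2.2, h3.1]
  -- The margins `0` of `v` and `δ` of `w` combine to the positive margin `t δ`.
  have hstrict := IsStrictNear.convexComb hH hB hc hi hd hv hw hs0 ht0 hst
    (hv.isStrictNear_zero k x₂) (hs x₂ hx₂)
  exact not_isStrictNear_of_isMax hH hB hc hi hd hz hu (M := convexComb (1 - t) t v w x₂ i₂ - u x₂ i₂)
    hmax₂ ⟨i₂, rfl⟩ k (by positivity) hstrict

end Aubry

end WCS

theorem mainTheorem1 {N m : ℕ}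
    (H : Fin m → WCS.Torus N → WCS.Momentum N → ℝ)
    (B : WCS.Torus N → Matrix (Fin m) (Fin m) ℝ)
    (hH : ∀ i, WCS.IsConvexHamiltonian (H i))
    (hBcont : ∀ i j, Continuous fun x => B x i j)
    (hBcoupling : ∀ x, WCS.IsCoupling (B x))
    (hBirreducible : ∀ x, WCS.IsIrreducible (B x))
    (hBdegenerate : ∀ x, WCS.IsDegenerate (B x))
    (k : Fin m) :
    (∀ v u : WCS.Torus N → Fin m → ℝ,
      WCS.IsCriticalSubsolution H B v → WCS.IsCriticalSupersolution H B u →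
      (∀ x ∈ WCS.aubrySet H B k, ∃ i, v x i ≤ u x i) →
      ∀ x i, v x i ≤ u x i) ∧
    (∀ u w : WCS.Torus N → Fin m → ℝ,
      WCS.IsCriticalSolution H B u → WCS.IsCriticalSolution H B w →
      (∀ x ∈ WCS.aubrySet H B k, u x = w x) →
      ∀ x, u x = w x) := by
  have comparison : ∀ v u : WCS.Torus N → Fin m → ℝ,
      WCS.IsCriticalSubsolution H B v → WCS.IsCriticalSupersolution H B u →
      (∀ x ∈ WCS.aubrySet H B k, ∃ i, v x i ≤ u x i) → ∀ x i, v x i ≤ u x i := by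
    intro v u hv hu hA x i
    obtain ⟨y, hy, hmax⟩ := WCS.exists_mem_aubrySet_isMax hH hBcont hBcoupling hBirreducible
      hBdegenerate k hv hu
    -- Every component is maximal at `y`, so whichever index `j` the hypothesis provides bounds the
    -- whole difference by zero.
    obtain ⟨j, hj⟩ := hA y hy
    linarith [hmax j x i]
  refine ⟨comparison, fun u w hu hw hA x => funext fun i => le_antisymm ?_ ?_⟩
  · exact comparison u w hu.1 hw.2 (fun x hx => ⟨k, (congrFun (hA x hx) k).le⟩) x i
  · exact comparison w u hw.1 hu.2 (fun x hx => ⟨k, (congrFun (hA x hx) k).ge⟩) x i
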